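/- Let $n\ge 3$ and let $M$ be a compact smooth $n$-dimensional manifold with non-empty smooth boundary $\partial M$. For a smooth Riemannian metric $g$ on $M$ let $R_g$ be its scalar curvature, $H_g$ the mean curvature of $\partial M$ (the trace of the second fundamental form with respect to the outward unit normal $\nu$, so that the Euclidean unit ball has $H=n-1$), $dv$ and $d\sigma$ the Riemannian measures of $M$ and of $\partial M$, and $$E_g(u)=\int_M\Big(\frac{4(n-1)}{n-2}|\nabla u|_g^2+R_gu^2\Big)dv+2\int_{\partial M}H_gu^2\,d\sigma .$$ Let $\lambda_1(\mathcal L,g)$ be the first eigenvalue of the problem $-\Delta_g\varphi+\frac{n-2}{4(n-1)}R_g\varphi=\lambda\varphi$ in $M$, $\frac{\partial\varphi}{\partial\nu}+\frac{n-2}{2(n-1)}H_g\varphi=0$ on $\partial M$, and $\lambda_1(\mathcal B,g)$ the first eigenvalue of the problem $-\Delta_g\varphi+\frac{n-2}{4(n-1)}R_g\varphi=0$ in $M$, $\frac{\partial\varphi}{\partial\nu}+\frac{n-2}{2(n-1)}H_g\varphi=\lambda\varphi$ on $\partial M$, both understood variationally: $$\lambda_1(\mathcal L,g)=\inf_{u\in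 C^\infty(M),\,u\not\equiv0}\frac{\frac{n-2}{4(n-1)}E_g(u)}{\int_Mu^2\,dv},\qquad \lambda_1(\mathcal B,g)=\inf_{u\in C^\infty(M),\,u|_{\partial M}\not\equiv0}\frac{\frac{n-2}{4(n-1)}E_g(u)}{\int_{\partial M}u^2\,d\sigma}\in[-\infty,\infty).$$ Then there exists a smooth Riemannian metric $g$ on $M$ with $\lambda_1(\mathcal L,g)<0$ and $\lambda_1(\mathcal B,g)<0$. -/

import Mathlib

open scoped Manifold ContDiff
open MeasureTheory Set

noncomputable section

namespace ConformalBoundary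

/-- Smooth (`C^∞`) Riemannian metrics on a manifold with boundary `M` of dimension `n`. -/
abbrev SmoothMetric (n : ℕ) [NeZero n] (M : Type*) [TopologicalSpace M]
    [ChartedSpace (EuclideanHalfSpace n) M] [IsManifold (𝓡∂ n) ∞ M] :=
  Bundle.ContMDiffRiemannianMetric (IB := 𝓡∂ n) (n := ∞)
    (EuclideanSpace ℝ (Fin n)) (fun z : M => TangentSpace (𝓡∂ n) z)

/-! ### Coordinate expressions on the half space `{y | 0 ≤ y 0}` -/

section Coordinates

variable {n : ℕ} [NeZero n]

/-- The partial derivative `∂ᵢ f (y)` of a function on the half space `{y | 0 ≤ y 0}`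
(one-sided at the boundary). -/
def partialD (i : Fin n) (f : EuclideanSpace ℝ (Fin n) → ℝ) (y : EuclideanSpace ℝ (Fin n)) : ℝ :=
  fderivWithin ℝ f (range (𝓡∂ n)) y (EuclideanSpace.single i 1)

/-- The Christoffel symbol `Γᵏᵢⱼ` of a metric with coefficient matrix `G`. -/
def christoffel (G : EuclideanSpace ℝ (Fin n) → Matrix (Fin n) (Fin n) ℝ) (k i j : Fin n)
    (y : EuclideanSpace ℝ (Fin n)) : ℝ :=
  (1 / 2) * ∑ l, (G y)⁻¹ k l *
    (partialD i (fun w => G w j l) y + partialD j (fun w => G w i l) y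
      - partialD l (fun w => G w i j) y)

/-- The Ricci tensor
`Ricⱼₖ = ∂ᵢ Γⁱⱼₖ - ∂ⱼ Γⁱᵢₖ + Γⁱᵢₚ Γᵖⱼₖ - Γⁱⱼₚ Γᵖᵢₖ` (positive on round spheres). -/
def ricci (G : EuclideanSpace ℝ (Fin n) → Matrix (Fin n) (Fin n) ℝ) (j k : Fin n)
    (y : EuclideanSpace ℝ (Fin n)) : ℝ :=
  ∑ i, (partialD i (christoffel G i j k) y - partialD j (christoffel G i i k) y
    + ∑ p, (christoffel G i i p y * christoffel G p j k y
        - christoffel G i j p y * christoffel G p i k y))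

/-- The scalar curvature `gʲᵏ Ricⱼₖ`. -/
def coordScalar (G : EuclideanSpace ℝ (Fin n) → Matrix (Fin n) (Fin n) ℝ)
    (y : EuclideanSpace ℝ (Fin n)) : ℝ :=
  ∑ j, ∑ k, (G y)⁻¹ j k * ricci G j k y

/-- The components `-g^{k0} / √g^{00}` of the unit normal to `{y | y 0 = 0}` that points out of
`{y | 0 ≤ y 0}`. -/
def coordNormal (G : EuclideanSpace ℝ (Fin n) → Matrix (Fin n) (Fin n) ℝ)
    (y : EuclideanSpace ℝ (Fin n)) (k : Fin n) : ℝ :=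
  -(G y)⁻¹ k 0 / √((G y)⁻¹ 0 0)

/-- The matrix, in the tangential coordinates, of the metric induced on `{y | y 0 = 0}`. -/
def tangentialGram (A : Matrix (Fin n) (Fin n) ℝ) :
    Matrix {i : Fin n // i ≠ 0} {i : Fin n // i ≠ 0} ℝ :=
  A.submatrix Subtype.val Subtype.val

/-- The second fundamental form `Π(∂ᵢ, ∂ⱼ) = g(∇ᵢ ν, ∂ⱼ) = -g(ν, ∇ᵢ ∂ⱼ)` of `{y | y 0 = 0}` for the
outward unit normal `ν`, in the tangential coordinates. -/
def secondFund (G : EuclideanSpace ℝ (Fin n) → Matrix (Fin n) (Fin n) ℝ)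
    (i j : {i : Fin n // i ≠ 0}) (y : EuclideanSpace ℝ (Fin n)) : ℝ :=
  -∑ k, ∑ l, G y k l * coordNormal G y k * christoffel G l i j y

/-- The mean curvature of `{y | y 0 = 0}`: the trace of the second fundamental form with respect to
the induced metric (`n - 1` for the boundary of the Euclidean unit ball). -/
def coordMean (G : EuclideanSpace ℝ (Fin n) → Matrix (Fin n) (Fin n) ℝ)
    (y : EuclideanSpace ℝ (Fin n)) : ℝ :=
  ∑ i, ∑ j, (tangentialGram (G y))⁻¹ i j * secondFund G i j y

/-- The squared length `gⁱʲ ∂ᵢu ∂ⱼu` of the gradient. -/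
def coordGradSq (G : EuclideanSpace ℝ (Fin n) → Matrix (Fin n) (Fin n) ℝ)
    (u : EuclideanSpace ℝ (Fin n) → ℝ) (y : EuclideanSpace ℝ (Fin n)) : ℝ :=
  ∑ i, ∑ j, (G y)⁻¹ i j * partialD i u y * partialD j u y

/-- The inclusion of the boundary hyperplane `{y | y 0 = 0}`. -/
def boundaryIncl (w : EuclideanSpace ℝ {i : Fin n // i ≠ 0}) : EuclideanSpace ℝ (Fin n) :=
  WithLp.toLp 2 (fun i => if h : i = 0 then 0 else w ⟨i, h⟩)

end Coordinates

/-! ### The same objects on a manifold with boundary -/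

section Manifold

variable {n : ℕ} [NeZero n] {M : Type*} [TopologicalSpace M]
  [ChartedSpace (EuclideanHalfSpace n) M] [IsManifold (𝓡∂ n) ∞ M]

/-- The coefficients `gᵢⱼ = g(∂ᵢ, ∂ⱼ)` of `g` in the chart around `x`, where `∂ᵢ` is the image of
the `i`-th standard vector under the derivative of the inverse chart. -/
def gram (g : SmoothMetric n M) (x : M) (y : EuclideanSpace ℝ (Fin n)) :
    Matrix (Fin n) (Fin n) ℝ :=
  Matrix.of fun i j =>
    g.inner ((extChartAt (𝓡∂ n) x).symm y)
      (mfderivWithin 𝓘(ℝ, EuclideanSpace ℝ (Fin n)) (𝓡∂ n) (extChartAt (𝓡∂ n) x).symm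
        (range (𝓡∂ n)) y (EuclideanSpace.single i (1 : ℝ) : EuclideanSpace ℝ (Fin n)))
      (mfderivWithin 𝓘(ℝ, EuclideanSpace ℝ (Fin n)) (𝓡∂ n) (extChartAt (𝓡∂ n) x).symm
        (range (𝓡∂ n)) y (EuclideanSpace.single j (1 : ℝ) : EuclideanSpace ℝ (Fin n)))

/-- The scalar curvature `R_g`, computed at each point in the preferred chart there. -/
def scalarCurvature (g : SmoothMetric n M) (z : M) : ℝ :=
  coordScalar (gram g z) (extChartAt (𝓡∂ n) z z)

/-- The mean curvature `H_g` of the boundary (meaningful at boundary points only). -/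
def meanCurvature (g : SmoothMetric n M) (z : M) : ℝ :=
  coordMean (gram g z) (extChartAt (𝓡∂ n) z z)

/-- The squared length `|∇u|²` of the gradient of `u`. -/
def gradSq (g : SmoothMetric n M) (u : M → ℝ) (z : M) : ℝ :=
  coordGradSq (gram g z) (u ∘ (extChartAt (𝓡∂ n) z).symm) (extChartAt (𝓡∂ n) z z)

variable [MeasurableSpace M]

/-- The Riemannian volume on the domain of the chart around `x`, namely `√(det gᵢⱼ) dy`. -/
def chartVolume (g : SmoothMetric n M) (x : M) : Measure M :=
  (((volume : Measure (EuclideanSpace ℝ (Fin n))).restrict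
      (extChartAt (𝓡∂ n) x).target).withDensity
    (fun y => ENNReal.ofReal (√(gram g x y).det))).map (extChartAt (𝓡∂ n) x).symm

/-- The Riemannian volume measure `dv`: the least measure that dominates the chart volumes. As the
chart volumes are the restrictions of one measure to the chart domains, and countably many of these
cover `M`, it is that measure. -/
def riemannianVolume (g : SmoothMetric n M) : Measure M :=
  ⨆ x : M, chartVolume g x

/-- The Riemannian measure of the boundary on the domain of the chart around `x`, viewed as a
measure on `M`. -/
def chartBoundaryVolume (g : SmoothMetric n M) (x : M) : Measure M :=
  (((volume : Measure (EuclideanSpace ℝ {i : Fin n // i ≠ 0})).restrict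
      (boundaryIncl ⁻¹' (extChartAt (𝓡∂ n) x).target)).withDensity
    (fun w => ENNReal.ofReal (√(tangentialGram (gram g x (boundaryIncl w))).det))).map
      (fun w => (extChartAt (𝓡∂ n) x).symm (boundaryIncl w))

/-- The Riemannian measure `dσ` of the boundary, as a measure on `M` carried by the boundary. -/
def boundaryVolume (g : SmoothMetric n M) : Measure M :=
  ⨆ x : M, chartBoundaryVolume g x

/-- The quadratic form of the conformal Laplacian with its conformal boundary operator:
`E_g(u) = ∫_M (4(n-1)/(n-2) |∇u|² + R_g u²) dv + 2 ∫_{∂M} H_g u² dσ`. -/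
def energy (g : SmoothMetric n M) (u : M → ℝ) : ℝ :=
  (∫ z, (4 * ((n : ℝ) - 1) / ((n : ℝ) - 2) * gradSq g u z + scalarCurvature g z * u z ^ 2)
      ∂(riemannianVolume g))
    + 2 * ∫ z, meanCurvature g z * u z ^ 2 ∂(boundaryVolume g)

/-- The first eigenvalue `λ₁(L)` of `-Δφ + (n-2)/(4(n-1)) R φ = λ φ` in `M`,
`∂φ/∂ν + (n-2)/(2(n-1)) H φ = 0` on `∂M`: the infimum of the Rayleigh quotient
`(n-2)/(4(n-1)) E_g(u) / ∫_M u² dv` over smooth functions that do not vanish identically. -/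
def firstEigenvalueL (g : SmoothMetric n M) : EReal :=
  ⨅ (u : C^∞⟮𝓡∂ n, M; ℝ⟯) (_ : 0 < ∫ z, u z ^ 2 ∂(riemannianVolume g)),
    ((((n : ℝ) - 2) / (4 * ((n : ℝ) - 1)) * energy g u
      / ∫ z, u z ^ 2 ∂(riemannianVolume g) : ℝ) : EReal)

/-- The first eigenvalue `λ₁(B)` of `-Δφ + (n-2)/(4(n-1)) R φ = 0` in `M`,
`∂φ/∂ν + (n-2)/(2(n-1)) H φ = λ φ` on `∂M`: the infimum of the Rayleigh quotient
`(n-2)/(4(n-1)) E_g(u) / ∫_{∂M} u² dσ` over smooth functions that do not vanish identically on the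
boundary. It is `-∞` if the first Dirichlet eigenvalue of the conformal Laplacian is negative. -/
def firstEigenvalueB (g : SmoothMetric n M) : EReal :=
  ⨅ (u : C^∞⟮𝓡∂ n, M; ℝ⟯) (_ : 0 < ∫ z, u z ^ 2 ∂(boundaryVolume g)),
    ((((n : ℝ) - 2) / (4 * ((n : ℝ) - 1)) * energy g u
      / ∫ z, u z ^ 2 ∂(boundaryVolume g) : ℝ) : EReal)

end Manifold

end ConformalBoundary

end

/-! One smooth function `u` with negative energy, not identically zero on the boundary, makes both
Rayleigh quotients negative. So it suffices to build a metric near one boundary point `p` and a test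
function supported there. The mean curvature is never computed.

In the chart at `p`, where the boundary is `y 0 = 0`, the metric is prescribed as `∑ᵢ Cᵢ exp (2 κ εᵢ
y₀) (dyᵢ)²`, with `C 0 = 1`, `ε 0 = 0`, `∑ εᵢ = 0` and `∑ εᵢ² = 2`. The weights are `1` and `-1` on
two tangential directions, available because `n ≥ 3`, and `0` elsewhere. This is a Sol-type
geometry: the scalar curvature is the constant `-2 κ²` (`coordScalar_expMetric`) and the volume
density is constant (`det_expMetric`). A partition of unity extends the metric to `M`
(`exists_metric_eq_on`).

The test function in the chart is `t b + b₀`, where `b` is a bump function and `b₀ = b · y₀`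
vanishes on the boundary. Three choices are made in order. First `κ` is taken so large that the
curvature term of `b₀` beats twice its Euclidean Dirichlet energy (times the constant `c`). Then the
tangential `Cᵢ` are taken so large that the metric dominates the Euclidean one on the support of
`b`, so gradient terms are bounded by Euclidean ones, independently of `κ`. This fixes `g`. Finally
`t > 0` is taken small. On the boundary `u` equals `t` times the bump, so the boundary term is `t²`
times a fixed number, whatever the mean curvature is. The rest is `t²` times a constant plus a fixed
negative number, hence negative for small `t`, while `t ≠ 0` keeps `u` nonzero on the boundary.

Much of the work links these coordinate computations to the definitions. Curvature and gradient are
defined at each point in that point's own chart, so their coordinate invariance is needed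
(`IsPullback.coordScalar_eq`, `IsPullback.coordGradSq_eq`). The measures are suprema of chart
measures, and the change of variables formula identifies them with a single chart measure on each
chart domain (`chartVolume_le`, `chartBoundaryVolume_le`, `restrict_iSup_eq`). -/

noncomputable section

namespace ConformalBoundary

open scoped Topology Matrix
open Filter

section Calculus

variable {n : ℕ} [NeZero n]

local notation "𝔼" => EuclideanSpace ℝ (Fin n)
local notation "ℍ" => range (𝓡∂ n)

/-! ### Calculus on the half space -/

lemma uniqueDiffWithinAt_halfSpace {y : 𝔼} (hy : y ∈ ℍ) : UniqueDiffWithinAt ℝ ℍ y :=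
  (𝓡∂ n).uniqueDiffOn y hy

lemma partialD_congr {f g : 𝔼 → ℝ} {y : 𝔼} (hy : y ∈ ℍ) (h : f =ᶠ[𝓝[ℍ] y] g) (i : Fin n) :
    partialD i f y = partialD i g y := by
  unfold partialD
  rw [h.fderivWithin_eq (h.self_of_nhdsWithin hy)]

lemma partialD_const (c : ℝ) (i : Fin n) (y : 𝔼) : partialD i (fun _ => c) y = 0 := by
  simp [partialD]

lemma partialD_add {f g : 𝔼 → ℝ} {y : 𝔼} (hy : y ∈ ℍ) (hf : DifferentiableWithinAt ℝ f ℍ y)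
    (hg : DifferentiableWithinAt ℝ g ℍ y) (i : Fin n) :
    partialD i (fun w => f w + g w) y = partialD i f y + partialD i g y := by
  unfold partialD
  rw [fderivWithin_fun_add (uniqueDiffWithinAt_halfSpace hy) hf hg]; rfl

lemma partialD_mul {f g : 𝔼 → ℝ} {y : 𝔼} (hy : y ∈ ℍ) (hf : DifferentiableWithinAt ℝ f ℍ y)
    (hg : DifferentiableWithinAt ℝ g ℍ y) (i : Fin n) :
    partialD i (fun w => f w * g w) y = partialD i f y * g y + f y * partialD i g y := by
  unfold partialD
  rw [fderivWithin_fun_mul (uniqueDiffWithinAt_halfSpace hy) hf hg]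
  simp; ring

lemma partialD_sum {ι : Type*} (s : Finset ι) {f : ι → 𝔼 → ℝ} {y : 𝔼} (hy : y ∈ ℍ)
    (hf : ∀ k ∈ s, DifferentiableWithinAt ℝ (f k) ℍ y) (i : Fin n) :
    partialD i (fun w => ∑ k ∈ s, f k w) y = ∑ k ∈ s, partialD i (f k) y := by
  unfold partialD
  rw [fderivWithin_fun_sum (uniqueDiffWithinAt_halfSpace hy) hf]; simp

lemma ContDiffWithinAt.partialD {f : 𝔼 → ℝ} {y : 𝔼} (hy : y ∈ ℍ)
    (hf : ContDiffWithinAt ℝ ∞ f ℍ y) (i : Fin n) :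
    ContDiffWithinAt ℝ ∞ (partialD i f) ℍ y :=
  (hf.fderivWithin_right (m := ∞) (𝓡∂ n).uniqueDiffOn (by simp) hy).clm_apply
    contDiffWithinAt_const

/-- Symmetry of second derivatives remains valid for one-sided derivatives at boundary points
because every point of the half space lies in the closure of its interior. -/
lemma partialD_comm {f : 𝔼 → ℝ} {y : 𝔼} (hy : y ∈ ℍ) (hf : ContDiffWithinAt ℝ ∞ f ℍ y)
    (i j : Fin n) : partialD i (partialD j f) y = partialD j (partialD i f) y := by
  have hd : DifferentiableWithinAt ℝ (fderivWithin ℝ f ℍ) ℍ y :=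
    (hf.fderivWithin_right (m := ∞) (𝓡∂ n).uniqueDiffOn (by simp) hy).differentiableWithinAt
      (by simp)
  have key : ∀ i j : Fin n, ConformalBoundary.partialD i (ConformalBoundary.partialD j f) y =
      fderivWithin ℝ (fderivWithin ℝ f ℍ) ℍ y (EuclideanSpace.single i 1)
        (EuclideanSpace.single j 1) := by
    intro i j
    unfold ConformalBoundary.partialD
    rw [fderivWithin_clm_apply (uniqueDiffWithinAt_halfSpace hy) hd
      (differentiableWithinAt_const _)]
    simp
  rw [key, key]
  exact (hf.isSymmSndFDerivWithinAt (n := ∞) (by simpa using ENat.LEInfty.out)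
    (𝓡∂ n).uniqueDiffOn ((𝓡∂ n).range_subset_closure_interior hy) hy).eq _ _

/-- The Jacobian matrix of a map of the half space. -/
def jac (τ : 𝔼 → 𝔼) (y : 𝔼) : Matrix (Fin n) (Fin n) ℝ :=
  Matrix.of fun a i => partialD i (fun w => τ w a) y

lemma jac_apply (τ : 𝔼 → 𝔼) {y : 𝔼} (hy : y ∈ ℍ) (hτ : DifferentiableWithinAt ℝ τ ℍ y)
    (a i : Fin n) : jac τ y a i = fderivWithin ℝ τ ℍ y (EuclideanSpace.single i 1) a := by
  have h := ((EuclideanSpace.proj a : 𝔼 →L[ℝ] ℝ).hasFDerivAt.comp_hasFDerivWithinAt y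
    hτ.hasFDerivWithinAt).fderivWithin (uniqueDiffWithinAt_halfSpace hy)
  simp only [jac, Matrix.of_apply, partialD]
  erw [h]
  rfl

/-- The chain rule for partial derivatives on the half space. -/
lemma partialD_comp {τ : 𝔼 → 𝔼} {f : 𝔼 → ℝ} {D : Set 𝔼} {y : 𝔼} (hy : y ∈ ℍ)
    (hD : D ∈ 𝓝[ℍ] y) (hτ : DifferentiableWithinAt ℝ τ ℍ y) (hmaps : MapsTo τ D ℍ)
    (hf : DifferentiableWithinAt ℝ f ℍ (τ y)) (i : Fin n) :
    partialD i (fun w => f (τ w)) y = ∑ a, jac τ y a i * partialD a f (τ y) := by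
  have h1 : HasFDerivWithinAt τ (fderivWithin ℝ τ ℍ y) (D ∩ ℍ) y :=
    hτ.hasFDerivWithinAt.mono inter_subset_right
  -- The map is only known to land in the half space on `D`. Since `D ∩ ℍ` is a relative
  -- neighbourhood of `y`, the derivative within it is also the derivative within `ℍ`.
  have h2 := (hf.hasFDerivWithinAt.comp y h1 (hmaps.mono_left inter_subset_left)).mono_of_mem_nhdsWithin
    (inter_mem hD self_mem_nhdsWithin)
  have h3 := h2.fderivWithin (uniqueDiffWithinAt_halfSpace hy)
  have h4 : partialD i (fun w => f (τ w)) y =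
      fderivWithin ℝ f ℍ (τ y) (fderivWithin ℝ τ ℍ y (EuclideanSpace.single i 1)) := by
    unfold partialD
    erw [h3]; rfl
  have h5 : ∀ v : 𝔼, v = ∑ a, v a • EuclideanSpace.single a (1 : ℝ) := by
    intro v; ext b; simp [Finset.sum_apply, Pi.single_apply]
  rw [h4, h5 (fderivWithin ℝ τ ℍ y (EuclideanSpace.single i 1)), map_sum]
  refine Finset.sum_congr rfl fun a _ => ?_
  rw [map_smul, jac_apply τ hy hτ, smul_eq_mul]
  rfl

/-! ### Matrix valued functions -/

/-- Entrywise smoothness of a matrix valued function on the half space. -/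
def SmoothMat {m : Type*} (A : 𝔼 → Matrix m m ℝ) (y : 𝔼) : Prop :=
  ∀ a b, ContDiffWithinAt ℝ ∞ (fun w => A w a b) ℍ y

/-- The entrywise partial derivative of a matrix valued function. -/
def partialM (i : Fin n) (A : 𝔼 → Matrix (Fin n) (Fin n) ℝ) (y : 𝔼) : Matrix (Fin n) (Fin n) ℝ :=
  Matrix.of fun a b => partialD i (fun w => A w a b) y

lemma SmoothMat.mul {A B : 𝔼 → Matrix (Fin n) (Fin n) ℝ} {y : 𝔼} (hA : SmoothMat A y)
    (hB : SmoothMat B y) : SmoothMat (fun w => A w * B w) y := by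
  intro a b
  simp only [Matrix.mul_apply]
  exact ContDiffWithinAt.sum fun k _ => (hA a k).mul (hB k b)

lemma SmoothMat.transpose {A : 𝔼 → Matrix (Fin n) (Fin n) ℝ} {y : 𝔼} (hA : SmoothMat A y) :
    SmoothMat (fun w => (A w)ᵀ) y := fun a b => hA b a

lemma SmoothMat.partialM {A : 𝔼 → Matrix (Fin n) (Fin n) ℝ} {y : 𝔼} (hy : y ∈ ℍ)
    (hA : SmoothMat A y) (i : Fin n) : SmoothMat (partialM i A) y :=
  fun a b => ContDiffWithinAt.partialD hy (hA a b) i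

lemma SmoothMat.det {m : Type*} [Fintype m] [DecidableEq m] {A : 𝔼 → Matrix m m ℝ} {y : 𝔼}
    (hA : SmoothMat A y) : ContDiffWithinAt ℝ ∞ (fun w => (A w).det) ℍ y := by
  simp only [Matrix.det_apply]
  exact ContDiffWithinAt.sum fun σ _ => (contDiffWithinAt_prod fun k _ => hA _ _).const_smul _

lemma SmoothMat.inv {A : 𝔼 → Matrix (Fin n) (Fin n) ℝ} {y : 𝔼} (hA : SmoothMat A y)
    (h : (A y).det ≠ 0) : SmoothMat (fun w => (A w)⁻¹) y := by
  intro a b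
  simp only [Matrix.inv_def, Ring.inverse_eq_inv', Matrix.smul_apply, smul_eq_mul,
    Matrix.adjugate_apply]
  refine (hA.det.inv h).mul (SmoothMat.det fun c d => ?_)
  by_cases hc : c = b
  · subst hc; simp only [Matrix.updateRow_self]; exact contDiffWithinAt_const
  · simp only [Matrix.updateRow_ne hc]; exact hA c d

lemma SmoothMat.diff {A : 𝔼 → Matrix (Fin n) (Fin n) ℝ} {y : 𝔼} (hA : SmoothMat A y)
    (a b : Fin n) : DifferentiableWithinAt ℝ (fun w => A w a b) ℍ y :=
  (hA a b).differentiableWithinAt (by simp)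

lemma partialM_congr {A B : 𝔼 → Matrix (Fin n) (Fin n) ℝ} {y : 𝔼} (hy : y ∈ ℍ)
    (h : A =ᶠ[𝓝[ℍ] y] B) (i : Fin n) : partialM i A y = partialM i B y := by
  ext a b
  exact partialD_congr hy (h.mono fun w hw => by simp only [hw]) i

lemma partialM_mul {A B : 𝔼 → Matrix (Fin n) (Fin n) ℝ} {y : 𝔼} (hy : y ∈ ℍ)
    (hA : SmoothMat A y) (hB : SmoothMat B y) (i : Fin n) :
    partialM i (fun w => A w * B w) y = partialM i A y * B y + A y * partialM i B y := by
  ext a b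
  simp only [partialM, Matrix.of_apply, Matrix.add_apply, Matrix.mul_apply]
  rw [partialD_sum (f := fun k w => A w a k * B w k b) _ hy
    fun k _ => (hA.diff a k).mul (hB.diff k b), ← Finset.sum_add_distrib]
  exact Finset.sum_congr rfl fun k _ => partialD_mul hy (hA.diff a k) (hB.diff k b) i

lemma partialM_add {A B : 𝔼 → Matrix (Fin n) (Fin n) ℝ} {y : 𝔼} (hy : y ∈ ℍ)
    (hA : SmoothMat A y) (hB : SmoothMat B y) (i : Fin n) :
    partialM i (fun w => A w + B w) y = partialM i A y + partialM i B y := by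
  ext a b
  exact partialD_add hy (hA.diff a b) (hB.diff a b) i

lemma partialM_transpose (A : 𝔼 → Matrix (Fin n) (Fin n) ℝ) (y : 𝔼) (i : Fin n) :
    partialM i (fun w => (A w)ᵀ) y = (partialM i A y)ᵀ := rfl

lemma partialM_comm {A : 𝔼 → Matrix (Fin n) (Fin n) ℝ} {y : 𝔼} (hy : y ∈ ℍ)
    (hA : SmoothMat A y) (i j : Fin n) :
    partialM i (partialM j A) y = partialM j (partialM i A) y := by
  ext a b
  exact partialD_comm hy (hA a b) i j

end Calculus

end ConformalBoundary
end

noncomputable section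

namespace ConformalBoundary

open scoped Topology Matrix
open Filter

section Curvature

variable {n : ℕ} [NeZero n]

local notation "𝔼" => EuclideanSpace ℝ (Fin n)
local notation "ℍ" => range (𝓡∂ n)

/-! ### Coordinate invariance of the scalar curvature -/

/-- A smooth change of coordinates between relatively open subsets of the half space. -/
structure CoordChange (τ : 𝔼 → 𝔼) (D : Set 𝔼) : Prop where
  subset : D ⊆ ℍ
  mem_nhds : ∀ y ∈ D, D ∈ 𝓝[ℍ] y
  smooth : ∀ y ∈ D, ContDiffWithinAt ℝ ∞ τ ℍ y
  mapsTo : MapsTo τ D ℍ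
  det_ne : ∀ y ∈ D, (jac τ y).det ≠ 0

/-- The matrix `(Γᵢ)ᵏⱼ = Γᵏᵢⱼ`. -/
def connMat (G : 𝔼 → Matrix (Fin n) (Fin n) ℝ) (i : Fin n) (y : 𝔼) : Matrix (Fin n) (Fin n) ℝ :=
  Matrix.of fun k j => christoffel G k i j y

/-- The Christoffel symbols of the first kind, as a matrix. -/
def lowerMat (G : 𝔼 → Matrix (Fin n) (Fin n) ℝ) (i : Fin n) (y : 𝔼) : Matrix (Fin n) (Fin n) ℝ :=
  Matrix.of fun l j => (1 / 2) * (partialD i (fun w => G w j l) y + partialD j (fun w => G w i l) y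
      - partialD l (fun w => G w i j) y)

/-- The curvature `∂ₘ Aᵢ - ∂ᵢ Aₘ + [Aₘ, Aᵢ]` of a matrix valued connection form. -/
def curvMat (A : Fin n → 𝔼 → Matrix (Fin n) (Fin n) ℝ) (m i : Fin n) (y : 𝔼) :
    Matrix (Fin n) (Fin n) ℝ :=
  partialM m (A i) y - partialM i (A m) y + A m y * A i y - A i y * A m y

lemma connMat_eq (G : 𝔼 → Matrix (Fin n) (Fin n) ℝ) (i : Fin n) (y : 𝔼) :
    connMat G i y = (G y)⁻¹ * lowerMat G i y := by
  ext k j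
  simp only [connMat, christoffel, lowerMat, Matrix.of_apply, Matrix.mul_apply, Finset.mul_sum]
  exact Finset.sum_congr rfl fun l _ => by ring

/-- Writing Ricci as a contraction of the curvature of a matrix connection form lets its
transformation law be proved by matrix algebra. -/
lemma ricci_eq_curvMat (G : 𝔼 → Matrix (Fin n) (Fin n) ℝ) (j k : Fin n) (y : 𝔼) :
    ricci G j k y = ∑ i, curvMat (connMat G) i j y i k := by
  unfold ricci curvMat
  refine Finset.sum_congr rfl fun i _ => ?_
  simp only [Matrix.sub_apply, Matrix.add_apply, Matrix.mul_apply, Finset.sum_sub_distrib,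
    partialM, connMat, Matrix.of_apply]
  ring

lemma SmoothMat.lowerMat {G : 𝔼 → Matrix (Fin n) (Fin n) ℝ} {y : 𝔼} (hy : y ∈ ℍ)
    (hG : SmoothMat G y) (i : Fin n) : SmoothMat (lowerMat G i) y := by
  intro l j
  exact contDiffWithinAt_const.mul (((ContDiffWithinAt.partialD hy (hG j l) i).add
    (ContDiffWithinAt.partialD hy (hG i l) j)).sub (ContDiffWithinAt.partialD hy (hG i j) l))

lemma SmoothMat.connMat {G : 𝔼 → Matrix (Fin n) (Fin n) ℝ} {y : 𝔼} (hy : y ∈ ℍ)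
    (hG : SmoothMat G y) (hdet : (G y).det ≠ 0) (i : Fin n) : SmoothMat (connMat G i) y := by
  have : ConformalBoundary.connMat G i = fun w => (G w)⁻¹ * ConformalBoundary.lowerMat G i w :=
    funext fun w => connMat_eq G i w
  rw [this]
  exact (hG.inv hdet).mul (hG.lowerMat hy i)

lemma partialM_comp {τ : 𝔼 → 𝔼} {D : Set 𝔼} (hτ : CoordChange τ D) {y : 𝔼} (hy : y ∈ D)
    {A : 𝔼 → Matrix (Fin n) (Fin n) ℝ} (hA : SmoothMat A (τ y)) (i : Fin n) :
    partialM i (fun w => A (τ w)) y = ∑ a, jac τ y a i • partialM a A (τ y) := by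
  ext b c
  rw [Matrix.sum_apply]
  exact partialD_comp (f := fun w => A w b c) (hτ.subset hy) (hτ.mem_nhds y hy)
    ((hτ.smooth y hy).differentiableWithinAt (by simp)) hτ.mapsTo (hA.diff b c) i

namespace CoordChange

variable {τ : EuclideanSpace ℝ (Fin n) → EuclideanSpace ℝ (Fin n)} {D : Set (EuclideanSpace ℝ (Fin n))}

lemma contDiffWithinAt_comp (hτ : CoordChange τ D) {y : 𝔼} (hy : y ∈ D) {f : 𝔼 → ℝ}
    (hf : ContDiffWithinAt ℝ ∞ f ℍ (τ y)) : ContDiffWithinAt ℝ ∞ (fun w => f (τ w)) ℍ y :=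
  (hf.comp y ((hτ.smooth y hy).mono inter_subset_right)
    (hτ.mapsTo.mono_left inter_subset_left)).mono_of_mem_nhdsWithin
    (inter_mem (hτ.mem_nhds y hy) self_mem_nhdsWithin)

lemma smoothMat_comp (hτ : CoordChange τ D) {y : 𝔼} (hy : y ∈ D)
    {A : 𝔼 → Matrix (Fin n) (Fin n) ℝ} (hA : SmoothMat A (τ y)) :
    SmoothMat (fun w => A (τ w)) y :=
  fun a b => hτ.contDiffWithinAt_comp hy (hA a b)

lemma contDiffWithinAt_apply (hτ : CoordChange τ D) {y : 𝔼} (hy : y ∈ D) (a : Fin n) :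
    ContDiffWithinAt ℝ ∞ (fun w => τ w a) ℍ y :=
  (EuclideanSpace.proj a : 𝔼 →L[ℝ] ℝ).contDiff.contDiffAt.comp_contDiffWithinAt y
    (hτ.smooth y hy)

lemma smoothMat_jac (hτ : CoordChange τ D) {y : 𝔼} (hy : y ∈ D) : SmoothMat (jac τ) y :=
  fun a i => ContDiffWithinAt.partialD (hτ.subset hy) (hτ.contDiffWithinAt_apply hy a) i

lemma partialM_jac_symm (hτ : CoordChange τ D) {y : 𝔼} (hy : y ∈ D) (i j a : Fin n) :
    partialM i (jac τ) y a j = partialM j (jac τ) y a i :=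
  partialD_comm (hτ.subset hy) (hτ.contDiffWithinAt_apply hy a) i j

end CoordChange

/-- `Gt` is the pullback of the metric coefficients `G` under the change of coordinates `τ`. -/
structure IsPullback (τ : 𝔼 → 𝔼) (D : Set 𝔼) (Gt G : 𝔼 → Matrix (Fin n) (Fin n) ℝ) : Prop
    extends CoordChange τ D where
  smoothG : ∀ y ∈ D, SmoothMat G (τ y)
  symmG : ∀ y ∈ D, (G (τ y))ᵀ = G (τ y)
  detG : ∀ y ∈ D, (G (τ y)).det ≠ 0
  pullback : ∀ y ∈ D, Gt y = (jac τ y)ᵀ * G (τ y) * jac τ y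

/-! ### Transformation laws under a change of coordinates -/

namespace IsPullback

variable {τ : EuclideanSpace ℝ (Fin n) → EuclideanSpace ℝ (Fin n)} {D : Set (EuclideanSpace ℝ (Fin n))} 
  {Gt G : EuclideanSpace ℝ (Fin n) → Matrix (Fin n) (Fin n) ℝ}

lemma eventuallyEq (h : IsPullback τ D Gt G) {y : 𝔼} (hy : y ∈ D) :
    Gt =ᶠ[𝓝[ℍ] y] fun w => (jac τ w)ᵀ * (G (τ w) * jac τ w) := by
  filter_upwards [h.mem_nhds y hy] with w hw
  rw [h.pullback w hw, Matrix.mul_assoc]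

lemma smoothMat_aux (h : IsPullback τ D Gt G) {y : 𝔼} (hy : y ∈ D) :
    SmoothMat (fun w => G (τ w)) y := h.smoothMat_comp hy (h.smoothG y hy)

lemma smoothMat (h : IsPullback τ D Gt G) {y : 𝔼} (hy : y ∈ D) : SmoothMat Gt y := fun a b =>
  (((h.smoothMat_jac hy).transpose.mul
    ((h.smoothMat_aux hy).mul (h.smoothMat_jac hy))) a b).congr_of_eventuallyEq_of_mem
    ((h.eventuallyEq hy).mono fun w hw => by simp only [hw]) (h.subset hy)

lemma det_ne_zero (h : IsPullback τ D Gt G) {y : 𝔼} (hy : y ∈ D) : (Gt y).det ≠ 0 := by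
  rw [h.pullback y hy, Matrix.det_mul, Matrix.det_mul, Matrix.det_transpose]
  exact mul_ne_zero (mul_ne_zero (h.det_ne y hy) (h.detG y hy)) (h.det_ne y hy)

/-- Leibniz rule for `Jᵀ G J`; by symmetry of `G`, the terms from differentiating `Jᵀ` and `J` are
transposes of each other. -/
lemma partialM_eq (h : IsPullback τ D Gt G) {y : 𝔼} (hy : y ∈ D) (i : Fin n) :
    partialM i Gt y = ((jac τ y)ᵀ * G (τ y) * partialM i (jac τ) y)ᵀ
      + (jac τ y)ᵀ * G (τ y) * partialM i (jac τ) y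
      + (jac τ y)ᵀ * (∑ b, jac τ y b i • partialM b G (τ y)) * jac τ y := by
  have hyS := h.subset hy
  have hJ := h.smoothMat_jac hy
  have hG := h.smoothMat_aux hy
  rw [partialM_congr hyS (h.eventuallyEq hy), partialM_mul hyS hJ.transpose (hG.mul hJ),
    partialM_mul hyS hG hJ, partialM_transpose, partialM_comp h.toCoordChange hy (h.smoothG y hy)]
  simp only [Matrix.transpose_mul, Matrix.transpose_transpose, h.symmG y hy]
  noncomm_ring

lemma mul_sum_smul_mul_apply (J : Matrix (Fin n) (Fin n) ℝ)
    (X : Fin n → Matrix (Fin n) (Fin n) ℝ) (i l j : Fin n) :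
    (Jᵀ * (∑ b, J b i • X b) * J) l j = ∑ b, ∑ a, ∑ c, J b i * J a l * J c j * X b a c := by
  simp only [Matrix.mul_sum, Matrix.sum_mul, Matrix.sum_apply, Matrix.mul_smul, Matrix.smul_mul,
    Matrix.smul_apply, smul_eq_mul]
  refine Finset.sum_congr rfl fun b _ => ?_
  simp only [Matrix.mul_apply, Finset.mul_sum, Finset.sum_mul, Matrix.transpose_apply]
  rw [Finset.sum_comm]
  exact Finset.sum_congr rfl fun a _ => Finset.sum_congr rfl fun c _ => by ring

/-- The inhomogeneous term of the transformation law appears here. Of the six terms containing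
second derivatives of `τ`, symmetry in the differentiation indices cancels four and leaves two equal
ones. The first derivatives of `G` transform tensorially. -/
lemma lowerMat_eq (h : IsPullback τ D Gt G) {y : 𝔼} (hy : y ∈ D) (i : Fin n) :
    lowerMat Gt i y = (jac τ y)ᵀ * G (τ y) * partialM i (jac τ) y
      + (jac τ y)ᵀ * (∑ b, jac τ y b i • lowerMat G b (τ y)) * jac τ y := by
  set J := jac τ y with hJ
  set K : Fin n → Matrix (Fin n) (Fin n) ℝ := fun i => Jᵀ * G (τ y) * partialM i (jac τ) y with hK
  have hKs : ∀ i l j, K i l j = K j l i := by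
    intro i l j
    simp only [hK]
    rw [Matrix.mul_apply, Matrix.mul_apply]
    exact Finset.sum_congr rfl fun a _ => by rw [h.partialM_jac_symm hy i j a]
  have hP : ∀ i a b, partialD i (fun w => Gt w a b) y = K i b a + K i a b +
      ∑ d, ∑ e, ∑ f, J d i * J e a * J f b * partialM d G (τ y) e f := by
    intro i a b
    have := congrFun (congrFun (h.partialM_eq hy i) a) b
    rw [Matrix.add_apply, Matrix.add_apply, mul_sum_smul_mul_apply] at this
    exact this
  ext l j
  rw [Matrix.add_apply, mul_sum_smul_mul_apply]
  -- The three relabellings `e1`, `e2`, `e3` bring the derivative terms to the common weight `J b i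
  -- * J a l * J c j`, so that they combine into `lowerMat G`.
  have e1 : ∑ d, ∑ e, ∑ f, J d i * J e j * J f l * partialM d G (τ y) e f =
      ∑ b, ∑ a, ∑ c, J b i * J a l * J c j * partialM b G (τ y) c a := by
    refine Finset.sum_congr rfl fun b _ => ?_
    rw [Finset.sum_comm]
    exact Finset.sum_congr rfl fun a _ => Finset.sum_congr rfl fun c _ => by ring
  have e2 : ∑ d, ∑ e, ∑ f, J d j * J e i * J f l * partialM d G (τ y) e f =
      ∑ b, ∑ a, ∑ c, J b i * J a l * J c j * partialM c G (τ y) b a := by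
    rw [Finset.sum_comm]
    refine Finset.sum_congr rfl fun b _ => ?_
    rw [Finset.sum_comm]
    exact Finset.sum_congr rfl fun a _ => Finset.sum_congr rfl fun c _ => by ring
  have e3 : ∑ d, ∑ e, ∑ f, J d l * J e i * J f j * partialM d G (τ y) e f =
      ∑ b, ∑ a, ∑ c, J b i * J a l * J c j * partialM a G (τ y) b c := by
    rw [Finset.sum_comm]
    exact Finset.sum_congr rfl fun b _ => Finset.sum_congr rfl fun a _ =>
      Finset.sum_congr rfl fun c _ => by ring
  have e4 : ∑ b, ∑ a, ∑ c, J b i * J a l * J c j * lowerMat G b (τ y) a c =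
      (1 / 2) * (∑ b, ∑ a, ∑ c, J b i * J a l * J c j * partialM b G (τ y) c a
        + ∑ b, ∑ a, ∑ c, J b i * J a l * J c j * partialM c G (τ y) b a
        - ∑ b, ∑ a, ∑ c, J b i * J a l * J c j * partialM a G (τ y) b c) := by
    simp only [← Finset.sum_add_distrib, ← Finset.sum_sub_distrib, Finset.mul_sum]
    refine Finset.sum_congr rfl fun b _ => Finset.sum_congr rfl fun a _ =>
      Finset.sum_congr rfl fun c _ => ?_
    simp only [lowerMat, partialM, Matrix.of_apply]
    ring
  rw [e4]
  change (1 / 2) * (partialD i (fun w => Gt w j l) y + partialD j (fun w => Gt w i l) y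
      - partialD l (fun w => Gt w i j) y) = K i l j + _
  rw [hP, hP, hP, e1, e2, e3, hKs l j i, hKs l i j, hKs j l i]
  ring

/-- The transformation law of the Christoffel symbols. -/
lemma jac_mul_connMat (h : IsPullback τ D Gt G) {y : 𝔼} (hy : y ∈ D) (i : Fin n) :
    jac τ y * connMat Gt i y = partialM i (jac τ) y
      + (∑ b, jac τ y b i • connMat G b (τ y)) * jac τ y := by
  have hJu : IsUnit (jac τ y).det := isUnit_iff_ne_zero.2 (h.det_ne y hy)
  have hGu : IsUnit (G (τ y)).det := isUnit_iff_ne_zero.2 (h.detG y hy)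
  have hJtu : IsUnit (jac τ y)ᵀ.det := by rwa [Matrix.det_transpose]
  have key : jac τ y * (Gt y)⁻¹ * (jac τ y)ᵀ = (G (τ y))⁻¹ := by
    rw [h.pullback y hy, Matrix.mul_inv_rev, Matrix.mul_inv_rev, ← Matrix.mul_assoc,
      Matrix.mul_nonsing_inv _ hJu, Matrix.one_mul, Matrix.mul_assoc,
      Matrix.nonsing_inv_mul _ hJtu, Matrix.mul_one]
  have hs : (∑ b, jac τ y b i • connMat G b (τ y)) =
      (G (τ y))⁻¹ * ∑ b, jac τ y b i • lowerMat G b (τ y) := by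
    rw [Matrix.mul_sum]
    exact Finset.sum_congr rfl fun b _ => by rw [connMat_eq, Matrix.mul_smul]
  rw [connMat_eq, h.lowerMat_eq hy, hs]
  calc _ = (jac τ y * (Gt y)⁻¹ * (jac τ y)ᵀ) * G (τ y) * partialM i (jac τ) y
        + (jac τ y * (Gt y)⁻¹ * (jac τ y)ᵀ) * (∑ b, jac τ y b i • lowerMat G b (τ y)) * jac τ y := by
        noncomm_ring
    _ = _ := by rw [key, Matrix.nonsing_inv_mul _ hGu, Matrix.one_mul]

lemma smoothMat_sum_smul (h : IsPullback τ D Gt G) {y : 𝔼} (hy : y ∈ D) (i : Fin n) :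
    SmoothMat (fun w => ∑ b, jac τ w b i • connMat G b (τ w)) y := by
  intro a c
  simp only [Matrix.sum_apply, Matrix.smul_apply, smul_eq_mul]
  exact ContDiffWithinAt.sum fun b _ => (h.smoothMat_jac hy b i).mul
    (h.smoothMat_comp hy ((h.smoothG y hy).connMat (h.mapsTo hy) (h.detG y hy) b) a c)

/-- The first sum is symmetric in `m` and `i`, so it drops out of the curvature; the second is the
tensorial part. -/
lemma partialM_sum_smul (h : IsPullback τ D Gt G) {y : 𝔼} (hy : y ∈ D) (m i : Fin n) :
    partialM m (fun w => ∑ b, jac τ w b i • connMat G b (τ w)) y =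
      (∑ b, partialM m (jac τ) y b i • connMat G b (τ y)) +
        ∑ d, ∑ b, (jac τ y d m * jac τ y b i) • partialM d (connMat G b) (τ y) := by
  have hyS := h.subset hy
  have hA := fun b => (h.smoothG y hy).connMat (h.mapsTo hy) (h.detG y hy) b
  ext a c
  have e : ∀ w, (∑ b, jac τ w b i • connMat G b (τ w)) a c
      = ∑ b, jac τ w b i * connMat G b (τ w) a c := fun w => by
    simp [Matrix.sum_apply]
  simp only [partialM, Matrix.of_apply, e]
  rw [partialD_sum (f := fun b w => jac τ w b i * connMat G b (τ w) a c) _ hyS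
    fun b _ => ((h.smoothMat_jac hy).diff b i).mul ((h.smoothMat_comp hy (hA b)).diff a c)]
  have e2 : ∀ b, partialD m (fun w => jac τ w b i * connMat G b (τ w) a c) y =
      partialD m (fun w => jac τ w b i) y * connMat G b (τ y) a c +
      ∑ d, jac τ y d m * jac τ y b i * partialD d (fun w => connMat G b w a c) (τ y) := by
    intro b
    rw [partialD_mul hyS ((h.smoothMat_jac hy).diff b i) ((h.smoothMat_comp hy (hA b)).diff a c),
      partialD_comp (f := fun w => connMat G b w a c) hyS (h.mem_nhds y hy)
        ((h.smooth y hy).differentiableWithinAt (by simp)) h.mapsTo ((hA b).diff a c),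
      Finset.mul_sum]
    congr 1
    exact Finset.sum_congr rfl fun d _ => by ring
  simp only [e2, Finset.sum_add_distrib, Matrix.add_apply, Matrix.sum_apply, Matrix.smul_apply,
    smul_eq_mul, Matrix.of_apply]
  congr 1
  exact Finset.sum_comm

/-- The curvature is the pullback of the curvature, conjugated by the Jacobian matrix. -/
lemma jac_mul_curvMat (h : IsPullback τ D Gt G) {y : 𝔼} (hy : y ∈ D) (m i : Fin n) :
    jac τ y * curvMat (connMat Gt) m i y =
      (∑ d, ∑ b, (jac τ y d m * jac τ y b i) • curvMat (connMat G) d b (τ y)) * jac τ y := by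
  have hyS := h.subset hy
  have hJ := h.smoothMat_jac hy
  have hA := fun b => (h.smoothMat hy).connMat hyS (h.det_ne_zero hy) b
  -- `B` is the pulled back connection form. The law `J Ãᵢ = ∂ᵢJ + Bᵢ J` says that `Ã` is its gauge
  -- transform by `J`, so differentiating this law once more relates the curvatures.
  set B : Fin n → 𝔼 → Matrix (Fin n) (Fin n) ℝ :=
    fun i w => ∑ b, jac τ w b i • connMat G b (τ w) with hB
  have hBs : ∀ i, SmoothMat (B i) y := fun i => h.smoothMat_sum_smul hy i
  have law : ∀ i, jac τ y * connMat Gt i y = partialM i (jac τ) y + B i y * jac τ y :=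
    fun i => h.jac_mul_connMat hy i
  have dlaw : ∀ m i, partialM m (jac τ) y * connMat Gt i y + jac τ y * partialM m (connMat Gt i) y
      = partialM m (partialM i (jac τ)) y +
        (partialM m (B i) y * jac τ y + B i y * partialM m (jac τ) y) := by
    intro m i
    rw [← partialM_mul hyS hJ (hA i), ← partialM_mul hyS (hBs i) hJ,
      ← partialM_add hyS (hJ.partialM hyS i) ((hBs i).mul hJ)]
    exact partialM_congr hyS (by
      filter_upwards [h.mem_nhds y hy] with w hw using h.jac_mul_connMat hw i) m
  have hFB : partialM m (B i) y - partialM i (B m) y + B m y * B i y - B i y * B m y =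
      ∑ d, ∑ b, (jac τ y d m * jac τ y b i) • curvMat (connMat G) d b (τ y) := by
    have s1 : (∑ b, partialM m (jac τ) y b i • connMat G b (τ y)) =
        ∑ b, partialM i (jac τ) y b m • connMat G b (τ y) :=
      Finset.sum_congr rfl fun b _ => by rw [h.partialM_jac_symm hy]
    have s2 : B m y * B i y = ∑ d, ∑ b, (jac τ y d m * jac τ y b i) •
        (connMat G d (τ y) * connMat G b (τ y)) := by
      simp only [hB, Matrix.sum_mul, Matrix.mul_sum, Matrix.smul_mul, Matrix.mul_smul, Finset.smul_sum,
        smul_smul]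
      rw [Finset.sum_comm]
      exact Finset.sum_congr rfl fun d _ => Finset.sum_congr rfl fun b _ => by rw [mul_comm]
    have s3 : B i y * B m y = ∑ d, ∑ b, (jac τ y d m * jac τ y b i) •
        (connMat G b (τ y) * connMat G d (τ y)) := by
      simp only [hB, Matrix.sum_mul, Matrix.mul_sum, Matrix.smul_mul, Matrix.mul_smul, Finset.smul_sum,
        smul_smul]
    have s4 : (∑ d, ∑ b, (jac τ y d i * jac τ y b m) • partialM d (connMat G b) (τ y)) =
        ∑ d, ∑ b, (jac τ y d m * jac τ y b i) • partialM b (connMat G d) (τ y) := by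
      rw [Finset.sum_comm]
      exact Finset.sum_congr rfl fun d _ => Finset.sum_congr rfl fun b _ => by rw [mul_comm]
    rw [s2, s3, h.partialM_sum_smul hy m i, h.partialM_sum_smul hy i m, s1, s4]
    simp only [curvMat, smul_sub, smul_add, Finset.sum_add_distrib, Finset.sum_sub_distrib]
    abel
  rw [← hFB]
  have h1 := dlaw m i
  have h2 := dlaw i m
  rw [partialM_comm hyS hJ i m] at h2
  -- The first derivatives of `J` are eliminated through the law itself; its mixed second
  -- derivatives cancel on antisymmetrization.
  have l1 : partialM m (jac τ) y = jac τ y * connMat Gt m y - B m y * jac τ y := by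
    rw [law m]; abel
  have l2 : partialM i (jac τ) y = jac τ y * connMat Gt i y - B i y * jac τ y := by
    rw [law i]; abel
  rw [l1, ← eq_sub_iff_add_eq'] at h1
  rw [l2, ← eq_sub_iff_add_eq'] at h2
  unfold curvMat
  calc _ = jac τ y * partialM m (connMat Gt i) y - jac τ y * partialM i (connMat Gt m) y
        + jac τ y * connMat Gt m y * connMat Gt i y
        - jac τ y * connMat Gt i y * connMat Gt m y := by noncomm_ring
    _ = _ := by
      rw [h1, h2]
      noncomm_ring

/-- The Ricci tensor of a pullback metric is the pullback of the Ricci tensor. -/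
lemma ricci_eq (h : IsPullback τ D Gt G) {y : 𝔼} (hy : y ∈ D) :
    (Matrix.of fun j k => ricci Gt j k y) =
      (jac τ y)ᵀ * (Matrix.of fun j k => ricci G j k (τ y)) * jac τ y := by
  have hJu : IsUnit (jac τ y).det := isUnit_iff_ne_zero.2 (h.det_ne y hy)
  set J := jac τ y with hJ
  have hF : ∀ m i, curvMat (connMat Gt) m i y =
      ∑ d, ∑ b, (J d m * J b i) • (J⁻¹ * curvMat (connMat G) d b (τ y) * J) := by
    intro m i
    have := congrArg (fun X => J⁻¹ * X) (h.jac_mul_curvMat hy m i)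
    simp only [← hJ] at this
    rw [← Matrix.mul_assoc, Matrix.nonsing_inv_mul _ hJu, Matrix.one_mul] at this
    rw [this]
    simp only [Matrix.sum_mul, Matrix.mul_sum, Matrix.smul_mul, Matrix.mul_smul, Matrix.mul_assoc]
  -- Ricci contracts the upper index with one form index, so the factors `J` and `J⁻¹` attached to
  -- these two indices cancel, leaving one `J` for each free index.
  have hinv : ∀ d a, ∑ i, J d i * J⁻¹ i a = if d = a then 1 else 0 := by
    intro d a
    have := congrFun (congrFun (Matrix.mul_nonsing_inv J hJu) d) a
    rwa [Matrix.mul_apply, Matrix.one_apply] at this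
  ext j k
  rw [Matrix.of_apply, ricci_eq_curvMat]
  calc ∑ i, curvMat (connMat Gt) i j y i k
      = ∑ i, ∑ d, ∑ b, ∑ a, (J d i * J⁻¹ i a) *
          (J b j * (curvMat (connMat G) d b (τ y) * J) a k) := by
        refine Finset.sum_congr rfl fun i _ => ?_
        rw [hF, Matrix.sum_apply]
        refine Finset.sum_congr rfl fun d _ => ?_
        rw [Matrix.sum_apply]
        refine Finset.sum_congr rfl fun b _ => ?_
        rw [Matrix.smul_apply, Matrix.mul_assoc, Matrix.mul_apply, smul_eq_mul, Finset.mul_sum]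
        exact Finset.sum_congr rfl fun a _ => by ring
    _ = ∑ d, ∑ b, ∑ a, (∑ i, J d i * J⁻¹ i a) *
          (J b j * (curvMat (connMat G) d b (τ y) * J) a k) := by
        simp only [Finset.sum_mul]
        rw [Finset.sum_comm]
        refine Finset.sum_congr rfl fun d _ => ?_
        rw [Finset.sum_comm]
        refine Finset.sum_congr rfl fun b _ => ?_
        rw [Finset.sum_comm]
    _ = ∑ d, ∑ b, J b j * (curvMat (connMat G) d b (τ y) * J) d k := by
        simp only [hinv, ite_mul, one_mul, zero_mul, Finset.sum_ite_eq, Finset.mem_univ, if_true]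
    _ = _ := by
        rw [Matrix.mul_assoc, Matrix.mul_apply, Finset.sum_comm]
        refine Finset.sum_congr rfl fun b _ => ?_
        rw [Matrix.transpose_apply, ← Finset.mul_sum]
        congr 1
        simp only [Matrix.mul_apply, Matrix.of_apply, ricci_eq_curvMat, Finset.sum_mul]
        rw [Finset.sum_comm]

lemma inv_eq (h : IsPullback τ D Gt G) {y : 𝔼} (hy : y ∈ D) :
    (Gt y)⁻¹ = (jac τ y)⁻¹ * (G (τ y))⁻¹ * ((jac τ y)⁻¹)ᵀ := by
  rw [h.pullback y hy, Matrix.mul_inv_rev, Matrix.mul_inv_rev, Matrix.transpose_nonsing_inv,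
    Matrix.mul_assoc]

lemma coordScalar_eq_trace (G : 𝔼 → Matrix (Fin n) (Fin n) ℝ) (y : 𝔼) :
    coordScalar G y = Matrix.trace ((G y)⁻¹ * (Matrix.of fun j k => ricci G j k y)ᵀ) := by
  simp [coordScalar, Matrix.trace, Matrix.mul_apply]

/-- The scalar curvature does not depend on the coordinates. -/
theorem coordScalar_eq (h : IsPullback τ D Gt G) {y : 𝔼} (hy : y ∈ D) :
    coordScalar Gt y = coordScalar G (τ y) := by
  have hJu : IsUnit (jac τ y).det := isUnit_iff_ne_zero.2 (h.det_ne y hy)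
  have hJtu : IsUnit (jac τ y)ᵀ.det := by rwa [Matrix.det_transpose]
  rw [coordScalar_eq_trace, coordScalar_eq_trace, h.ricci_eq hy, h.inv_eq hy,
    Matrix.transpose_nonsing_inv]
  simp only [Matrix.transpose_mul, Matrix.transpose_transpose]
  rw [Matrix.mul_assoc, Matrix.mul_assoc, Matrix.trace_mul_comm, ← Matrix.mul_assoc (jac τ y)ᵀ⁻¹,
    Matrix.nonsing_inv_mul _ hJtu, Matrix.one_mul, Matrix.mul_assoc, Matrix.mul_assoc,
    Matrix.mul_nonsing_inv _ hJu, Matrix.mul_one]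

/-- The length of the gradient does not depend on the coordinates. -/
theorem coordGradSq_eq (h : IsPullback τ D Gt G) {y : 𝔼} (hy : y ∈ D) {u : 𝔼 → ℝ}
    (hu : DifferentiableWithinAt ℝ u ℍ (τ y)) :
    coordGradSq Gt (fun w => u (τ w)) y = coordGradSq G u (τ y) := by
  have hJu : IsUnit (jac τ y).det := isUnit_iff_ne_zero.2 (h.det_ne y hy)
  have hJtu : IsUnit (jac τ y)ᵀ.det := by rwa [Matrix.det_transpose]
  have hdot : ∀ (G : 𝔼 → Matrix (Fin n) (Fin n) ℝ) (u : 𝔼 → ℝ) (y : 𝔼), coordGradSq G u y =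
      (fun i => partialD i u y) ⬝ᵥ ((G y)⁻¹ *ᵥ fun i => partialD i u y) := by
    intro G u y
    simp only [coordGradSq, dotProduct, Matrix.mulVec, Finset.mul_sum]
    exact Finset.sum_congr rfl fun i _ => Finset.sum_congr rfl fun j _ => by ring
  have hv : (fun i => partialD i (fun w => u (τ w)) y) =
      (jac τ y)ᵀ *ᵥ fun i => partialD i u (τ y) := by
    ext i
    rw [partialD_comp (h.subset hy) (h.mem_nhds y hy)
      ((h.smooth y hy).differentiableWithinAt (by simp)) h.mapsTo hu]
    rfl
  rw [hdot, hdot, hv, h.inv_eq hy, Matrix.transpose_nonsing_inv, Matrix.mulVec_mulVec,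
    Matrix.mul_assoc, Matrix.nonsing_inv_mul _ hJtu, Matrix.mul_one, ← Matrix.vecMul_transpose,
    Matrix.transpose_transpose, ← Matrix.dotProduct_mulVec, Matrix.mulVec_mulVec,
    ← Matrix.mul_assoc, Matrix.mul_nonsing_inv _ hJu, Matrix.one_mul]

end IsPullback

end Curvature

end ConformalBoundary
end

noncomputable section

namespace ConformalBoundary

open scoped Topology Matrix
open Filter

section Sol

variable {n : ℕ} [NeZero n]

local notation "𝔼" => EuclideanSpace ℝ (Fin n)
local notation "ℍ" => range (𝓡∂ n)

/-! ### A family of metrics with constant negative scalar curvature -/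

/-- The metric `∑ᵢ Cᵢ exp (2 κ εᵢ yₐ) (dyᵢ)²`. -/
def expMetric (κ : ℝ) (ε C : Fin n → ℝ) (a : Fin n) (y : 𝔼) : Matrix (Fin n) (Fin n) ℝ :=
  Matrix.diagonal fun i => C i * Real.exp (2 * κ * ε i * y a)

variable {κ : ℝ} {ε C : Fin n → ℝ} {a : Fin n}

lemma expMetric_apply (i j : Fin n) (y : EuclideanSpace ℝ (Fin n)) :
    expMetric κ ε C a y i j = if i = j then C i * Real.exp (2 * κ * ε i * y a) else 0 := by
  simp [expMetric, Matrix.diagonal_apply]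

lemma expMetric_inv (hC : ∀ i, C i ≠ 0) (y : EuclideanSpace ℝ (Fin n)) :
    (expMetric κ ε C a y)⁻¹ =
      Matrix.diagonal fun i => (C i * Real.exp (2 * κ * ε i * y a))⁻¹ := by
  refine Matrix.inv_eq_right_inv ?_
  rw [expMetric, Matrix.diagonal_mul_diagonal, ← Matrix.diagonal_one]
  congr 1
  ext i
  exact mul_inv_cancel₀ (mul_ne_zero (hC i) (Real.exp_pos _).ne')

lemma contDiff_expMetric_apply (i j : Fin n) :
    ContDiff ℝ ∞ fun w : EuclideanSpace ℝ (Fin n) => expMetric κ ε C a w i j := by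
  simp only [expMetric_apply]
  split_ifs
  · exact contDiff_const.mul (Real.contDiff_exp.comp (contDiff_const.mul
      (EuclideanSpace.proj a : EuclideanSpace ℝ (Fin n) →L[ℝ] ℝ).contDiff))
  · exact contDiff_const

lemma hasFDerivAt_mul_exp (c r : ℝ) (a : Fin n) (y : EuclideanSpace ℝ (Fin n)) :
    HasFDerivAt (fun w : EuclideanSpace ℝ (Fin n) => c * Real.exp (r * w a))
      ((r * (c * Real.exp (r * y a))) • (EuclideanSpace.proj a :
        EuclideanSpace ℝ (Fin n) →L[ℝ] ℝ)) y := by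
  have h := ((((EuclideanSpace.proj a : EuclideanSpace ℝ (Fin n) →L[ℝ] ℝ).hasFDerivAt
    (x := y)).const_mul r).exp).const_mul c
  refine HasFDerivAt.congr_fderiv h ?_
  ext v
  simp
  ring

lemma partialD_mul_exp (c r : ℝ) (a l : Fin n) {y : EuclideanSpace ℝ (Fin n)} (hy : y ∈ ℍ) :
    partialD l (fun w => c * Real.exp (r * w a)) y =
      if l = a then r * (c * Real.exp (r * y a)) else 0 := by
  unfold partialD
  rw [(hasFDerivAt_mul_exp c r a y).hasFDerivWithinAt.fderivWithin
    (uniqueDiffWithinAt_halfSpace hy)]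
  simp [Pi.single_apply, eq_comm]

lemma partialD_expMetric (l i j : Fin n) {y : EuclideanSpace ℝ (Fin n)} (hy : y ∈ ℍ) :
    partialD l (fun w => expMetric κ ε C a w i j) y =
      if i = j then if l = a then 2 * κ * ε i * (C i * Real.exp (2 * κ * ε i * y a)) else 0
        else 0 := by
  simp only [expMetric_apply]
  split_ifs with h1 h2 h2
  · rw [partialD_mul_exp _ _ _ _ hy, if_pos h2]
  · rw [partialD_mul_exp _ _ _ _ hy, if_neg h2]
  · exact partialD_const 0 l y

/-- Only the `yₐ`-derivatives of the diagonal entries survive, so the possibly nonzero symbols are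
`Γᵏₐₖ = Γᵏₖₐ = κ εₖ` and `Γᵃᵢᵢ = -κ εᵢ Cᵢ exp (2 κ εᵢ yₐ)`. The unit coefficient in the direction
`a` keeps the last one free of a denominator. -/
lemma christoffel_expMetric (hC : ∀ i, C i ≠ 0) (ha : C a = 1) (hε : ε a = 0) (k i j : Fin n)
    {y : EuclideanSpace ℝ (Fin n)} (hy : y ∈ ℍ) :
    christoffel (expMetric κ ε C a) k i j y =
      κ * ((if i = a then if j = k then ε k else 0 else 0)
        + (if j = a then if i = k then ε k else 0 else 0))
        + (if k = a then if i = j then -κ * ε i * C i else 0 else 0)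
          * Real.exp (2 * κ * ε i * y a) := by
  have hne : C k * Real.exp (2 * κ * ε k * y a) ≠ 0 := mul_ne_zero (hC k) (Real.exp_pos _).ne'
  have hg : k = a → C k * Real.exp (2 * κ * ε k * y a) = 1 := by
    rintro rfl; simp [ha, hε]
  obtain ⟨D, hD⟩ : ∃ D, D = if k = a then if i = j then -κ * ε i * C i else 0 else 0 := ⟨_, rfl⟩
  unfold christoffel
  rw [expMetric_inv hC, ← hD]
  simp only [partialD_expMetric _ _ _ hy, Matrix.diagonal_apply, ite_mul, zero_mul,
    Finset.sum_ite_eq, Finset.mem_univ, if_true]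
  set g := C k * Real.exp (2 * κ * ε k * y a) with hgdef
  have e1 : (if j = k then if i = a then 2 * κ * ε j * (C j * Real.exp (2 * κ * ε j * y a)) else 0
      else 0) = (if i = a then if j = k then ε k else 0 else 0) * (2 * κ * g) := by
    by_cases h1 : j = k <;> by_cases h2 : i = a <;> simp [h1, h2, hgdef]; ring
  have e2 : (if i = k then if j = a then 2 * κ * ε i * (C i * Real.exp (2 * κ * ε i * y a)) else 0
      else 0) = (if j = a then if i = k then ε k else 0 else 0) * (2 * κ * g) := by
    by_cases h1 : i = k <;> by_cases h2 : j = a <;> simp [h1, h2, hgdef]; ring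
  have e3 : (if i = j then if k = a then 2 * κ * ε i * (C i * Real.exp (2 * κ * ε i * y a)) else 0
      else 0) = -2 * g * (D * Real.exp (2 * κ * ε i * y a)) := by
    rw [hD]
    by_cases h1 : i = j
    · by_cases h2 : k = a
      · simp only [if_pos h1, if_pos h2, hg h2]; ring
      · simp [h2]
    · simp [h1]
  rw [e1, e2, e3]
  generalize (if i = a then if j = k then ε k else 0 else 0) = A
  generalize (if j = a then if i = k then ε k else 0 else 0) = B
  field_simp
  ring

lemma partialD_christoffel_expMetric (hC : ∀ i, C i ≠ 0) (ha : C a = 1) (hε : ε a = 0)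
    (l k i j : Fin n) {y : EuclideanSpace ℝ (Fin n)} (hy : y ∈ ℍ) :
    partialD l (christoffel (expMetric κ ε C a) k i j) y =
      if l = a then if k = a then if i = j then
        -(2 * κ ^ 2 * ε i ^ 2 * (C i * Real.exp (2 * κ * ε i * y a))) else 0 else 0 else 0 := by
  have h1 : christoffel (expMetric κ ε C a) k i j =ᶠ[𝓝[ℍ] y] fun y =>
      κ * ((if i = a then if j = k then ε k else 0 else 0)
        + (if j = a then if i = k then ε k else 0 else 0))
        + (if k = a then if i = j then -κ * ε i * C i else 0 else 0)
          * Real.exp (2 * κ * ε i * y a) := by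
    filter_upwards [self_mem_nhdsWithin] with w hw using christoffel_expMetric hC ha hε k i j hw
  rw [partialD_congr hy h1, partialD_add hy (differentiableWithinAt_const _)
    (hasFDerivAt_mul_exp _ _ a y).differentiableAt.differentiableWithinAt,
    partialD_const, partialD_mul_exp _ _ _ _ hy]
  split_ifs <;> ring

/-- In the direction `a`, only the quadratic term `-∑ (Γⁱₐᵢ)²` remains. In any other direction the
derivative of `Γᵃⱼⱼ` cancels the quadratic terms `2 Γʲⱼₐ Γᵃⱼⱼ`, and the trace term carries the
factor `∑ εᵢ = 0`. Diagonal entries suffice because the inverse metric is diagonal. -/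
lemma ricci_expMetric_self (hC : ∀ i, C i ≠ 0) (ha : C a = 1) (hε : ε a = 0)
    (hsum : ∑ i, ε i = 0) (j : Fin n) {y : EuclideanSpace ℝ (Fin n)} (hy : y ∈ ℍ) :
    ricci (expMetric κ ε C a) j j y = if j = a then -(κ ^ 2 * ∑ i, ε i ^ 2) else 0 := by
  unfold ricci
  simp only [partialD_christoffel_expMetric hC ha hε _ _ _ _ hy,
    christoffel_expMetric hC ha hε _ _ _ hy]
  set g : Fin n → ℝ := fun i => Real.exp (2 * κ * ε i * y a) with hg
  have hga : g a = 1 := by simp [hg, hε]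
  simp only [Finset.sum_add_distrib, Finset.sum_sub_distrib]
  by_cases hj : j = a
  · subst hj
    simp [hε, Finset.sum_add_distrib, mul_add, add_mul, Finset.sum_ite_eq, ite_mul, mul_ite]
    rw [Finset.mul_sum]
    exact Finset.sum_congr rfl fun i _ => by ring
  · simp [hε, hj, Finset.sum_add_distrib, mul_add, add_mul, Finset.sum_ite_eq, ite_mul, mul_ite]
    rw [← Finset.sum_mul, ← Finset.mul_sum, hsum]
    ring

/-- The scalar curvature of `∑ᵢ Cᵢ exp (2 κ εᵢ yₐ) (dyᵢ)²` if `∑ᵢ εᵢ = 0`. -/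
theorem coordScalar_expMetric (hC : ∀ i, C i ≠ 0) (ha : C a = 1) (hε : ε a = 0)
    (hsum : ∑ i, ε i = 0) {y : EuclideanSpace ℝ (Fin n)} (hy : y ∈ ℍ) :
    coordScalar (expMetric κ ε C a) y = -(κ ^ 2 * ∑ i, ε i ^ 2) := by
  unfold coordScalar
  rw [expMetric_inv hC]
  simp only [Matrix.diagonal_apply, ite_mul, zero_mul, Finset.sum_ite_eq, Finset.mem_univ, if_true,
    ricci_expMetric_self hC ha hε hsum _ hy, mul_ite, mul_zero, Finset.sum_ite_eq']
  simp [ha, hε]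

end Sol

end ConformalBoundary
end

noncomputable section

namespace ConformalBoundary

open scoped Topology Matrix
open Filter

section Metric

variable {n : ℕ} [NeZero n] {M : Type*} [TopologicalSpace M]
  [ChartedSpace (EuclideanHalfSpace n) M] [IsManifold (𝓡∂ n) ∞ M]

local notation "𝔼" => EuclideanSpace ℝ (Fin n)
local notation "ℍ" => range (𝓡∂ n)

/-! ### The coefficients of a metric in charts -/

/-- The derivative of the inverse of the chart around `x`, as a map to the tangent space at `z`. -/
def frame (x z : M) : EuclideanSpace ℝ (Fin n) →L[ℝ] TangentSpace (𝓡∂ n) z :=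
  (trivializationAt (EuclideanSpace ℝ (Fin n)) (TangentSpace (𝓡∂ n)) x).symmL ℝ z

/-- The derivative of the chart around `x`, as a map from the tangent space at `z`. -/
def coframe (x z : M) : TangentSpace (𝓡∂ n) z →L[ℝ] EuclideanSpace ℝ (Fin n) :=
  (trivializationAt (EuclideanSpace ℝ (Fin n)) (TangentSpace (𝓡∂ n)) x).continuousLinearMapAt ℝ z

lemma mem_baseSet {x z : M} (hz : z ∈ (extChartAt (𝓡∂ n) x).source) :
    z ∈ (trivializationAt (EuclideanSpace ℝ (Fin n)) (TangentSpace (𝓡∂ n)) x).baseSet := by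
  rw [TangentBundle.trivializationAt_baseSet]
  rwa [extChartAt_source] at hz

lemma coframe_frame {x z : M} (hz : z ∈ (extChartAt (𝓡∂ n) x).source)
    (v : EuclideanSpace ℝ (Fin n)) : coframe x z (frame x z v) = v :=
  Bundle.Trivialization.continuousLinearMapAt_symmL _ (mem_baseSet hz) v

lemma frame_coframe {x z : M} (hz : z ∈ (extChartAt (𝓡∂ n) x).source)
    (v : TangentSpace (𝓡∂ n) z) : frame x z (coframe x z v) = v :=
  Bundle.Trivialization.symmL_continuousLinearMapAt _ (mem_baseSet hz) v

/-- Replaces the manifold derivative in `gram` by the tangent bundle trivialization, for which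
smoothness and cocycle identities are available. -/
lemma gram_eq (g : SmoothMetric n M) {x z : M} (hz : z ∈ (extChartAt (𝓡∂ n) x).source)
    (i j : Fin n) : gram g x (extChartAt (𝓡∂ n) x z) i j =
      g.inner z (frame x z (EuclideanSpace.single i 1)) (frame x z (EuclideanSpace.single j 1)) := by
  have h : frame x z = mfderivWithin 𝓘(ℝ, EuclideanSpace ℝ (Fin n)) (𝓡∂ n)
      (extChartAt (𝓡∂ n) x).symm (range (𝓡∂ n)) (extChartAt (𝓡∂ n) x z) :=
    TangentBundle.symmL_trivializationAt (by rwa [extChartAt_source] at hz)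
  have hx : (extChartAt (𝓡∂ n) x).symm (extChartAt (𝓡∂ n) x z) = z :=
    (extChartAt (𝓡∂ n) x).left_inv hz
  rw [h]
  simp only [gram, Matrix.of_apply]
  rw [hx]
  rfl

lemma frame_eq_tangentCoordChange {x z : M} (hz : z ∈ (extChartAt (𝓡∂ n) x).source)
    (v : EuclideanSpace ℝ (Fin n)) : frame x z v = tangentCoordChange (𝓡∂ n) x z z v := by
  have := TangentBundle.symmL_trivializationAt_eq_core (I := 𝓡∂ n) (b₀ := x) (b := z)
    (by rwa [extChartAt_source] at hz)
  exact congrArg (fun L => L v) this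

/-- The transition map between the charts around `x` and `p`. -/
def transition (x p : M) : EuclideanSpace ℝ (Fin n) → EuclideanSpace ℝ (Fin n) :=
  extChartAt (𝓡∂ n) p ∘ (extChartAt (𝓡∂ n) x).symm

/-- The domain of the transition map between the charts around `x` and `p`. -/
def transitionDomain (x p : M) : Set (EuclideanSpace ℝ (Fin n)) :=
  (extChartAt (𝓡∂ n) x).target ∩ (extChartAt (𝓡∂ n) x).symm ⁻¹' (extChartAt (𝓡∂ n) p).source

lemma contDiffWithinAt_transition {x p : M} {y : EuclideanSpace ℝ (Fin n)}
    (hy : y ∈ transitionDomain x p) : ContDiffWithinAt ℝ ∞ (transition x p) ℍ y :=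
  contDiffWithinAt_ext_coord_change p x (by
    rw [PartialEquiv.trans_source]
    exact hy)

lemma mem_nhds_preimage_symm {x : M} {U : Set M} (hU : IsOpen U)
    {y : EuclideanSpace ℝ (Fin n)} (hy : y ∈ (extChartAt (𝓡∂ n) x).target)
    (hyU : (extChartAt (𝓡∂ n) x).symm y ∈ U) :
    (extChartAt (𝓡∂ n) x).target ∩ (extChartAt (𝓡∂ n) x).symm ⁻¹' U ∈ 𝓝[ℍ] y :=
  inter_mem (extChartAt_target_mem_nhdsWithin_of_mem hy)
    (nhdsWithin_le_nhds ((continuousAt_extChartAt_symm'' hy).preimage_mem_nhds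
      (hU.mem_nhds hyU)))

lemma jac_transition_apply {x p z : M} (hx : z ∈ (extChartAt (𝓡∂ n) x).source)
    (hp : z ∈ (extChartAt (𝓡∂ n) p).source) (a i : Fin n) :
    jac (transition x p) (extChartAt (𝓡∂ n) x z) a i =
      tangentCoordChange (𝓡∂ n) x p z (EuclideanSpace.single i 1) a := by
  have hy : extChartAt (𝓡∂ n) x z ∈ transitionDomain x p :=
    ⟨(extChartAt (𝓡∂ n) x).map_source hx, by rwa [mem_preimage, (extChartAt (𝓡∂ n) x).left_inv hx]⟩
  exact jac_apply _ (extChartAt_target_subset_range x hy.1)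
    ((contDiffWithinAt_transition hy).differentiableWithinAt (by simp)) a i

lemma jac_transition_eq_toMatrix {x p z : M} (hx : z ∈ (extChartAt (𝓡∂ n) x).source)
    (hp : z ∈ (extChartAt (𝓡∂ n) p).source) :
    jac (transition x p) (extChartAt (𝓡∂ n) x z) =
      LinearMap.toMatrix (EuclideanSpace.basisFun (Fin n) ℝ).toBasis
        (EuclideanSpace.basisFun (Fin n) ℝ).toBasis
        (tangentCoordChange (𝓡∂ n) x p z : EuclideanSpace ℝ (Fin n) →ₗ[ℝ] _) := by
  ext a i
  rw [jac_transition_apply hx hp, LinearMap.toMatrix_apply]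
  simp

lemma det_jac_transition_ne {x p z : M} (hx : z ∈ (extChartAt (𝓡∂ n) x).source)
    (hp : z ∈ (extChartAt (𝓡∂ n) p).source) :
    (jac (transition x p) (extChartAt (𝓡∂ n) x z)).det ≠ 0 := by
  have hcomp : jac (transition p x) (extChartAt (𝓡∂ n) p z) *
      jac (transition x p) (extChartAt (𝓡∂ n) x z) = 1 := by
    rw [jac_transition_eq_toMatrix hx hp, jac_transition_eq_toMatrix hp hx,
      ← LinearMap.toMatrix_comp,
      ← LinearMap.toMatrix_id (EuclideanSpace.basisFun (Fin n) ℝ).toBasis]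
    congr 1
    ext v : 1
    -- The cocycle identity from `x` to `p` and back makes the two Jacobians inverse to each other.
    have h1 := tangentCoordChange_comp (I := 𝓡∂ n) (w := x) (x := p) (y := x) (z := z) (v := v)
      ⟨⟨hx, hp⟩, hx⟩
    rw [tangentCoordChange_self hx] at h1
    exact h1
  have := congrArg Matrix.det hcomp
  rw [Matrix.det_mul, Matrix.det_one] at this
  exact right_ne_zero_of_mul_eq_one this

lemma coordChange_transition (x p : M) : CoordChange (transition x p) (transitionDomain (n := n) x p) where
  subset := fun _ hy => extChartAt_target_subset_range x hy.1
  mem_nhds := fun _ hy => mem_nhds_preimage_symm (isOpen_extChartAt_source p) hy.1 hy.2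
  smooth := fun _ hy => contDiffWithinAt_transition hy
  mapsTo := fun _ hy => extChartAt_target_subset_range p ((extChartAt (𝓡∂ n) p).map_source hy.2)
  det_ne := fun y hy => by
    have := det_jac_transition_ne ((extChartAt (𝓡∂ n) x).map_target hy.1) hy.2
    rwa [(extChartAt (𝓡∂ n) x).right_inv hy.1] at this

/-- The transformation law for the coefficients of a metric. -/
lemma gram_transition (g : SmoothMetric n M) {x p : M} {y : EuclideanSpace ℝ (Fin n)}
    (hy : y ∈ transitionDomain x p) :
    gram g x y = (jac (transition x p) y)ᵀ * gram g p (transition x p y) *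
      jac (transition x p) y := by
  obtain ⟨z, hz, rfl⟩ : ∃ z, z ∈ (extChartAt (𝓡∂ n) x).source ∧ extChartAt (𝓡∂ n) x z = y :=
    ⟨_, (extChartAt (𝓡∂ n) x).map_target hy.1, (extChartAt (𝓡∂ n) x).right_inv hy.1⟩
  have hp : z ∈ (extChartAt (𝓡∂ n) p).source := by
    have := hy.2
    rwa [mem_preimage, (extChartAt (𝓡∂ n) x).left_inv hz] at this
  have ht : transition x p (extChartAt (𝓡∂ n) x z) = extChartAt (𝓡∂ n) p z := by
    rw [transition, Function.comp_apply, (extChartAt (𝓡∂ n) x).left_inv hz]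
  have hframe : ∀ i, frame x z (EuclideanSpace.single i 1) =
      ∑ a, jac (transition x p) (extChartAt (𝓡∂ n) x z) a i •
        frame p z (EuclideanSpace.single a 1) := by
    intro i
    have h5 : ∀ v : EuclideanSpace ℝ (Fin n), v = ∑ a, v a • EuclideanSpace.single a (1 : ℝ) := by
      intro v; ext b; simp [Finset.sum_apply, Pi.single_apply]
    have h1 := tangentCoordChange_comp (I := 𝓡∂ n) (w := x) (x := p) (y := z) (z := z)
      (v := EuclideanSpace.single i 1) ⟨⟨hz, hp⟩, mem_extChartAt_source z⟩
    rw [← frame_eq_tangentCoordChange hz, ← frame_eq_tangentCoordChange hp] at h1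
    rw [← h1, h5 (tangentCoordChange (𝓡∂ n) x p z (EuclideanSpace.single i 1)), map_sum]
    exact Finset.sum_congr rfl fun a _ => by rw [map_smul, jac_transition_apply hz hp]
  ext i j
  rw [gram_eq g hz, ht, hframe i, hframe j]
  simp only [map_sum, map_smul, ContinuousLinearMap.sum_apply, ContinuousLinearMap.smul_apply,
    smul_eq_mul]
  simp only [Matrix.mul_apply, Matrix.transpose_apply, gram_eq g hp, Finset.sum_mul,
    Finset.mul_sum]
  exact Finset.sum_congr rfl fun a _ => Finset.sum_congr rfl fun b _ => by ring

lemma gram_posDef (g : SmoothMetric n M) {x : M} {y : EuclideanSpace ℝ (Fin n)}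
    (hy : y ∈ (extChartAt (𝓡∂ n) x).target) : (gram g x y).PosDef := by
  obtain ⟨z, hz, rfl⟩ : ∃ z, z ∈ (extChartAt (𝓡∂ n) x).source ∧ extChartAt (𝓡∂ n) x z = y :=
    ⟨_, (extChartAt (𝓡∂ n) x).map_target hy, (extChartAt (𝓡∂ n) x).right_inv hy⟩
  refine Matrix.PosDef.of_dotProduct_mulVec_pos ?_ ?_
  · ext i j
    simp only [Matrix.conjTranspose_apply, star_trivial, gram_eq g hz]
    exact g.symm z _ _
  · intro v hv
    have key : star v ⬝ᵥ (gram g x (extChartAt (𝓡∂ n) x z) *ᵥ v) =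
        g.inner z (frame x z (WithLp.toLp 2 v)) (frame x z (WithLp.toLp 2 v)) := by
      have h5 : (WithLp.toLp 2 v : EuclideanSpace ℝ (Fin n)) =
          ∑ a, v a • EuclideanSpace.single a (1 : ℝ) := by
        ext b; simp [Finset.sum_apply, Pi.single_apply]
      rw [h5]
      simp only [map_sum, map_smul, ContinuousLinearMap.sum_apply, ContinuousLinearMap.smul_apply,
        smul_eq_mul, dotProduct, Matrix.mulVec, gram_eq g hz, Finset.mul_sum, star_trivial,
        Pi.star_apply]
      refine Finset.sum_comm.trans (Finset.sum_congr rfl fun a _ =>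
        Finset.sum_congr rfl fun b _ => ?_)
      ring
    rw [key]
    refine g.pos z _ fun h0 => hv ?_
    have := coframe_frame hz (WithLp.toLp 2 v)
    rw [h0, map_zero] at this
    exact (congrArg (WithLp.ofLp) this).symm

lemma gram_symm (g : SmoothMetric n M) {x : M} {y : EuclideanSpace ℝ (Fin n)}
    (hy : y ∈ (extChartAt (𝓡∂ n) x).target) : (gram g x y)ᵀ = gram g x y := by
  have := (gram_posDef g hy).isHermitian.eq
  rwa [Matrix.conjTranspose_eq_transpose_of_trivial] at this

lemma det_gram_pos (g : SmoothMetric n M) {x : M} {y : EuclideanSpace ℝ (Fin n)}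
    (hy : y ∈ (extChartAt (𝓡∂ n) x).target) : 0 < (gram g x y).det :=
  (gram_posDef g hy).det_pos

end Metric

end ConformalBoundary
end

noncomputable section

namespace ConformalBoundary

open scoped Topology Matrix
open Filter

section Existence

variable {n : ℕ} [NeZero n] {M : Type*} [TopologicalSpace M]
  [ChartedSpace (EuclideanHalfSpace n) M] [IsManifold (𝓡∂ n) ∞ M]

local notation "𝔼" => EuclideanSpace ℝ (Fin n)
local notation "ℍ" => range (𝓡∂ n)

/-! ### Smoothness in charts and existence of metrics -/

/-- A section of the bundle of bilinear forms, read in the chart around `x`. -/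
def readForm (b : ∀ z : M, TangentSpace (𝓡∂ n) z →L[ℝ] TangentSpace (𝓡∂ n) z →L[ℝ] ℝ) (x z : M) :
    EuclideanSpace ℝ (Fin n) →L[ℝ] EuclideanSpace ℝ (Fin n) →L[ℝ] ℝ :=
  ((frame x z).precomp ℝ).comp ((b z).comp (frame x z))

/-- Smoothness of a section of the bundle of bilinear forms can be tested in a chart. -/
lemma contMDiffOn_section_iff_readForm
    (b : ∀ z : M, TangentSpace (𝓡∂ n) z →L[ℝ] TangentSpace (𝓡∂ n) z →L[ℝ] ℝ) (x : M) :
    ContMDiffOn (𝓡∂ n) ((𝓡∂ n).prod 𝓘(ℝ, EuclideanSpace ℝ (Fin n) →L[ℝ]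
        EuclideanSpace ℝ (Fin n) →L[ℝ] ℝ)) ∞
      (fun z => Bundle.TotalSpace.mk' (EuclideanSpace ℝ (Fin n) →L[ℝ]
        EuclideanSpace ℝ (Fin n) →L[ℝ] ℝ)
        (E := fun z : M => TangentSpace (𝓡∂ n) z →L[ℝ] TangentSpace (𝓡∂ n) z →L[ℝ] ℝ) z (b z))
      (extChartAt (𝓡∂ n) x).source ↔
    ContMDiffOn (𝓡∂ n) 𝓘(ℝ, EuclideanSpace ℝ (Fin n) →L[ℝ] EuclideanSpace ℝ (Fin n) →L[ℝ] ℝ) ∞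
      (readForm b x) (extChartAt (𝓡∂ n) x).source := by
  have hb : (trivializationAt (EuclideanSpace ℝ (Fin n) →L[ℝ] EuclideanSpace ℝ (Fin n) →L[ℝ] ℝ)
      (fun z : M => TangentSpace (𝓡∂ n) z →L[ℝ] TangentSpace (𝓡∂ n) z →L[ℝ] ℝ) x).baseSet =
      (extChartAt (𝓡∂ n) x).source := by
    rw [hom_trivializationAt_baseSet, hom_trivializationAt_baseSet,
      TangentBundle.trivializationAt_baseSet, extChartAt_source]
    simp
  have key := Bundle.Trivialization.contMDiffOn_section_baseSet_iff (n := ∞) (IB := 𝓡∂ n)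
    (F := EuclideanSpace ℝ (Fin n) →L[ℝ] EuclideanSpace ℝ (Fin n) →L[ℝ] ℝ) (s := b)
    (trivializationAt (EuclideanSpace ℝ (Fin n) →L[ℝ] EuclideanSpace ℝ (Fin n) →L[ℝ] ℝ)
      (fun z : M => TangentSpace (𝓡∂ n) z →L[ℝ] TangentSpace (𝓡∂ n) z →L[ℝ] ℝ) x)
  rw [hb] at key
  refine key.trans (contMDiffOn_congr fun z hz => ?_)
  ext v w
  rw [hom_trivializationAt_apply]
  rw [inCoordinates_apply_eq₂ (mem_baseSet hz) (mem_baseSet hz) (by simp)]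
  simp [readForm, frame, Bundle.Trivialization.symmL_apply _ (mem_baseSet hz)]

lemma smoothMat_gram (g : SmoothMetric n M) {x : M} {y : EuclideanSpace ℝ (Fin n)}
    (hy : y ∈ (extChartAt (𝓡∂ n) x).target) : SmoothMat (gram g x) y := by
  have h1 := (contMDiffOn_section_iff_readForm g.inner x).1 g.contMDiff.contMDiffOn
  have h2 := h1.comp (contMDiffOn_extChartAt_symm (I := 𝓡∂ n) (n := ∞) x)
    (fun w hw => (extChartAt (𝓡∂ n) x).map_target hw)
  have h3 := (contMDiffOn_iff_contDiffOn.1 h2 y hy).mono_of_mem_nhdsWithin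
    (extChartAt_target_mem_nhdsWithin_of_mem hy)
  intro i j
  refine ((h3.clm_apply (contDiffWithinAt_const (c := EuclideanSpace.single i 1))).clm_apply
    (contDiffWithinAt_const (c := EuclideanSpace.single j 1))).congr_of_eventuallyEq_of_mem ?_
    (extChartAt_target_subset_range x hy)
  filter_upwards [extChartAt_target_mem_nhdsWithin_of_mem hy] with w hw
  have := gram_eq g ((extChartAt (𝓡∂ n) x).map_target hw) i j
  rw [(extChartAt (𝓡∂ n) x).right_inv hw] at this
  exact this

/-- The metric structure asks for bounded unit balls. In finite dimension this follows from
positivity: the quadratic form has a positive minimum on the compact unit sphere, and homogeneity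
bounds the norm. -/
lemma isVonNBounded_of_pos (b : EuclideanSpace ℝ (Fin n) →L[ℝ] EuclideanSpace ℝ (Fin n) →L[ℝ] ℝ)
    (hb : ∀ v, v ≠ 0 → 0 < b v v) : Bornology.IsVonNBounded ℝ {v | b v v < 1} := by
  have hc : Continuous fun v => b v v := by fun_prop
  have : Nontrivial (EuclideanSpace ℝ (Fin n)) :=
    ⟨⟨EuclideanSpace.single 0 1, 0, fun h => by simpa using congrArg (fun v => v 0) h⟩⟩
  obtain ⟨v₀, hv₀, hmin⟩ := (isCompact_sphere (0 : EuclideanSpace ℝ (Fin n)) 1).exists_isMinOn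
    (NormedSpace.sphere_nonempty.2 zero_le_one) hc.continuousOn
  have hpos : 0 < b v₀ v₀ := hb v₀ fun h => by simp [h] at hv₀
  rw [NormedSpace.isVonNBounded_iff' ℝ]
  refine ⟨√(1 / b v₀ v₀), fun v hv => Real.le_sqrt_of_sq_le ?_⟩
  rw [le_div_iff₀ hpos]
  by_cases h0 : v = 0
  · simp [h0]
  have hn : ‖v‖ ≠ 0 := norm_ne_zero_iff.2 h0
  have h1 : b v₀ v₀ ≤ b (‖v‖⁻¹ • v) (‖v‖⁻¹ • v) := hmin (by simp [norm_smul, hn])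
  simp only [map_smul, ContinuousLinearMap.smul_apply, smul_eq_mul] at h1
  have h2 : ‖v‖ ^ 2 * (‖v‖⁻¹ * (‖v‖⁻¹ * b v v)) = b v v := by field_simp
  have h3 := mul_le_mul_of_nonneg_left h1 (sq_nonneg ‖v‖)
  rw [h2] at h3
  exact h3.trans (le_of_lt hv)

/-- The bilinear forms on the tangent spaces that are given by `c` in the chart around `x`. -/
def pullForm (c : EuclideanSpace ℝ (Fin n) →
      EuclideanSpace ℝ (Fin n) →L[ℝ] EuclideanSpace ℝ (Fin n) →L[ℝ] ℝ) (x z : M) :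
    TangentSpace (𝓡∂ n) z →L[ℝ] TangentSpace (𝓡∂ n) z →L[ℝ] ℝ :=
  ((coframe x z).precomp ℝ).comp ((c (extChartAt (𝓡∂ n) x z)).comp (coframe x z))

lemma pullForm_apply (c : EuclideanSpace ℝ (Fin n) →
      EuclideanSpace ℝ (Fin n) →L[ℝ] EuclideanSpace ℝ (Fin n) →L[ℝ] ℝ) (x z : M)
    (v w : TangentSpace (𝓡∂ n) z) :
    pullForm c x z v w = c (extChartAt (𝓡∂ n) x z) (coframe x z v) (coframe x z w) := rfl

lemma contMDiffOn_pullForm {c : EuclideanSpace ℝ (Fin n) →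
      EuclideanSpace ℝ (Fin n) →L[ℝ] EuclideanSpace ℝ (Fin n) →L[ℝ] ℝ} (hc : ContDiff ℝ ∞ c)
    (x : M) : ContMDiffOn (𝓡∂ n) ((𝓡∂ n).prod
      𝓘(ℝ, EuclideanSpace ℝ (Fin n) →L[ℝ] EuclideanSpace ℝ (Fin n) →L[ℝ] ℝ)) ∞
      (fun z => Bundle.TotalSpace.mk' (EuclideanSpace ℝ (Fin n) →L[ℝ]
        EuclideanSpace ℝ (Fin n) →L[ℝ] ℝ)
        (E := fun z : M => TangentSpace (𝓡∂ n) z →L[ℝ] TangentSpace (𝓡∂ n) z →L[ℝ] ℝ) z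
        (pullForm c x z)) (extChartAt (𝓡∂ n) x).source := by
  rw [contMDiffOn_section_iff_readForm]
  have h1 : ContMDiffOn (𝓡∂ n) 𝓘(ℝ, EuclideanSpace ℝ (Fin n)) ∞ (extChartAt (𝓡∂ n) x)
      (extChartAt (𝓡∂ n) x).source := by
    rw [extChartAt_source]; exact contMDiffOn_extChartAt
  refine (hc.contMDiff.comp_contMDiffOn h1).congr fun z hz => ?_
  ext v w
  change c (extChartAt (𝓡∂ n) x z) (coframe x z (frame x z v)) (coframe x z (frame x z w)) = _
  rw [coframe_frame hz, coframe_frame hz]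
  rfl

lemma coframe_ne_zero {x z : M} (hz : z ∈ (extChartAt (𝓡∂ n) x).source)
    {v : TangentSpace (𝓡∂ n) z} (hv : v ≠ 0) : coframe x z v ≠ 0 := by
  intro h0
  apply hv
  rw [← frame_coframe hz v, h0, map_zero]

/-- The inner products on a tangent space that are prescribed if `P` holds form a convex set. -/
lemma convex_innerProducts (z : M) (P : Prop)
    (c : TangentSpace (𝓡∂ n) z →L[ℝ] TangentSpace (𝓡∂ n) z →L[ℝ] ℝ) :
    Convex ℝ {a : TangentSpace (𝓡∂ n) z →L[ℝ] TangentSpace (𝓡∂ n) z →L[ℝ] ℝ |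
      (∀ v w, a v w = a w v) ∧ (∀ v, v ≠ 0 → 0 < a v v) ∧ (P → ∀ v w, a v w = c v w)} := by
  rintro a₁ ⟨h1, h2, h3⟩ a₂ ⟨k1, k2, k3⟩ r s hr hs hrs
  have e : ∀ v w, (r • a₁ + s • a₂) v w = r * a₁ v w + s * a₂ v w := fun v w => rfl
  refine ⟨fun v w => ?_, fun v hv => ?_, fun hz v w => ?_⟩
  · rw [e, e, h1 v w, k1 v w]
  · rw [e]
    rcases hr.eq_or_lt with rfl | hr'
    · have : s = 1 := by linarith
      simp [this, k2 v hv]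
    · have := mul_pos hr' (h2 v hv)
      have := mul_nonneg hs (k2 v hv).le
      linarith
  · rw [e, h3 hz, k3 hz, ← add_mul, hrs, one_mul]

set_option synthInstance.maxHeartbeats 200000 in
set_option maxHeartbeats 800000 in
/-- On a compact manifold there is a metric that has prescribed coefficients in the chart around
`p` on a given closed subset of the domain of this chart. -/
theorem exists_metric_eq_on [CompactSpace M] [T2Space M] (p : M) {K : Set M} (hK : IsClosed K)
    (hKp : K ⊆ (extChartAt (𝓡∂ n) p).source)
    (b : EuclideanSpace ℝ (Fin n) →
      EuclideanSpace ℝ (Fin n) →L[ℝ] EuclideanSpace ℝ (Fin n) →L[ℝ] ℝ)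
    (hb : ContDiff ℝ ∞ b) (hsymm : ∀ y v w, b y v w = b y w v) (hpos : ∀ y v, v ≠ 0 → 0 < b y v v) :
    ∃ g : SmoothMetric n M, ∀ z ∈ K, ∀ i j, gram g p (extChartAt (𝓡∂ n) p z) i j =
      b (extChartAt (𝓡∂ n) p z) (EuclideanSpace.single i 1) (EuclideanSpace.single j 1) := by
  have hloc : ∀ x₀ : M, ∃ U ∈ 𝓝 x₀, ∃ s : ∀ z : M,
      TangentSpace (𝓡∂ n) z →L[ℝ] TangentSpace (𝓡∂ n) z →L[ℝ] ℝ,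
      ContMDiffOn (𝓡∂ n) ((𝓡∂ n).prod
      𝓘(ℝ, EuclideanSpace ℝ (Fin n) →L[ℝ] EuclideanSpace ℝ (Fin n) →L[ℝ] ℝ)) ∞
      (fun z => Bundle.TotalSpace.mk' (EuclideanSpace ℝ (Fin n) →L[ℝ]
        EuclideanSpace ℝ (Fin n) →L[ℝ] ℝ)
        (E := fun z : M => TangentSpace (𝓡∂ n) z →L[ℝ] TangentSpace (𝓡∂ n) z →L[ℝ] ℝ) z (s z)) U ∧
      ∀ z ∈ U, s z ∈ {a : TangentSpace (𝓡∂ n) z →L[ℝ] TangentSpace (𝓡∂ n) z →L[ℝ] ℝ |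
        (∀ v w, a v w = a w v) ∧ (∀ v, v ≠ 0 → 0 < a v v) ∧
          (z ∈ K → ∀ v w, a v w = pullForm b p z v w)} := by
    intro x₀
    by_cases hx : x₀ ∈ (extChartAt (𝓡∂ n) p).source
    · refine ⟨_, (isOpen_extChartAt_source p).mem_nhds hx, pullForm b p,
        contMDiffOn_pullForm hb p, fun z hz => ⟨fun v w => ?_, fun v hv => ?_, fun _ _ _ => rfl⟩⟩
      · rw [pullForm_apply, pullForm_apply, hsymm]
      · rw [pullForm_apply]
        exact hpos _ _ (coframe_ne_zero hz hv)
    -- Away from the chart of `p`, the neighbourhood is shrunk to avoid the closed set `K`; the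
    -- prescription is then vacuous and the Euclidean product of the local chart serves.
    · refine ⟨(extChartAt (𝓡∂ n) x₀).source ∩ Kᶜ, inter_mem (extChartAt_source_mem_nhds x₀)
        (hK.isOpen_compl.mem_nhds fun h => hx (hKp h)), pullForm (fun _ => innerSL ℝ) x₀,
        (contMDiffOn_pullForm contDiff_const x₀).mono inter_subset_left,
        fun z hz => ⟨fun v w => ?_, fun v hv => ?_, fun h => absurd h hz.2⟩⟩
      · rw [pullForm_apply, pullForm_apply]
        exact real_inner_comm (coframe x₀ z w) (coframe x₀ z v)
      · rw [pullForm_apply]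
        exact real_inner_self_pos.2 (coframe_ne_zero hz.1 hv)
  -- Partition of unity: symmetry, positivity and the prescribed values are all preserved by convex
  -- combinations.
  obtain ⟨s, hs⟩ := exists_contMDiffSection_forall_mem_convex_of_local (n := ⊤) (𝓡∂ n)
    (fun z : M => TangentSpace (𝓡∂ n) z →L[ℝ] TangentSpace (𝓡∂ n) z →L[ℝ] ℝ) _
    (fun z => convex_innerProducts z (z ∈ K) (pullForm b p z)) hloc
  refine ⟨⟨s, fun z => (hs z).1, fun z => (hs z).2.1, fun z => ?_, s.contMDiff⟩, ?_⟩
  · exact isVonNBounded_of_pos (s z) (hs z).2.1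
  · intro z hz i j
    rw [gram_eq _ (hKp hz)]
    refine ((hs z).2.2 hz _ _).trans ?_
    rw [pullForm_apply, coframe_frame (hKp hz), coframe_frame (hKp hz)]

end Existence

end ConformalBoundary
end

noncomputable section

namespace ConformalBoundary

open scoped Topology Matrix
open Filter

section Invariance

variable {n : ℕ} [NeZero n] {M : Type*} [TopologicalSpace M]
  [ChartedSpace (EuclideanHalfSpace n) M] [IsManifold (𝓡∂ n) ∞ M]

local notation "𝔼" => EuclideanSpace ℝ (Fin n)
local notation "ℍ" => range (𝓡∂ n)

/-! ### Curvature and gradient in an arbitrary chart -/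

lemma CoordChange.mono {τ : EuclideanSpace ℝ (Fin n) → EuclideanSpace ℝ (Fin n)}
    {D D' : Set (EuclideanSpace ℝ (Fin n))} (h : CoordChange τ D) (hD : D' ⊆ D)
    (hn : ∀ y ∈ D', D' ∈ 𝓝[ℍ] y) : CoordChange τ D' where
  subset := hD.trans h.subset
  mem_nhds := hn
  smooth := fun y hy => h.smooth y (hD hy)
  mapsTo := h.mapsTo.mono_left hD
  det_ne := fun y hy => h.det_ne y (hD hy)

lemma transition_apply_chart {x p z : M} (hz : z ∈ (extChartAt (𝓡∂ n) x).source) :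
    transition x p (extChartAt (𝓡∂ n) x z) = extChartAt (𝓡∂ n) p z := by
  rw [transition, Function.comp_apply, (extChartAt (𝓡∂ n) x).left_inv hz]

/-- If the coefficients of `g` in the chart around `p` are given by `G` on an open set `U`, then
the coefficients in the chart around `x` are the pullback of `G`. -/
lemma isPullback_transition (g : SmoothMetric n M) {p : M} {U : Set M} (hU : IsOpen U)
    (hUp : U ⊆ (extChartAt (𝓡∂ n) p).source) {G : EuclideanSpace ℝ (Fin n) → Matrix (Fin n) (Fin n) ℝ}
    (hG : ∀ z ∈ U, gram g p (extChartAt (𝓡∂ n) p z) = G (extChartAt (𝓡∂ n) p z))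
    (hs : ∀ z ∈ U, SmoothMat G (extChartAt (𝓡∂ n) p z)) (x : M) :
    IsPullback (transition x p)
      ((extChartAt (𝓡∂ n) x).target ∩ (extChartAt (𝓡∂ n) x).symm ⁻¹' U) (gram g x) G where
  toCoordChange := (coordChange_transition x p).mono
    (inter_subset_inter_right _ (preimage_mono hUp))
    (fun _ hy => mem_nhds_preimage_symm hU hy.1 hy.2)
  smoothG := fun y hy => hs _ hy.2
  symmG := fun y hy => by
    rw [transition, Function.comp_apply, ← hG _ hy.2]
    exact gram_symm g ((extChartAt (𝓡∂ n) p).map_source (hUp hy.2))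
  detG := fun y hy => by
    rw [transition, Function.comp_apply, ← hG _ hy.2]
    exact (det_gram_pos g ((extChartAt (𝓡∂ n) p).map_source (hUp hy.2))).ne'
  pullback := fun y hy => by
    rw [gram_transition g ⟨hy.1, hUp hy.2⟩, transition, Function.comp_apply, ← hG _ hy.2]

/-- The definition uses the chart at `z`; invariance under the transition map moves the computation
to the chart at `p`. Openness of `U` matters since curvature involves two derivatives of the
coefficients. -/
lemma scalarCurvature_eq (g : SmoothMetric n M) {p : M} {U : Set M} (hU : IsOpen U)
    (hUp : U ⊆ (extChartAt (𝓡∂ n) p).source) {G : EuclideanSpace ℝ (Fin n) → Matrix (Fin n) (Fin n) ℝ}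
    (hG : ∀ z ∈ U, gram g p (extChartAt (𝓡∂ n) p z) = G (extChartAt (𝓡∂ n) p z))
    (hs : ∀ z ∈ U, SmoothMat G (extChartAt (𝓡∂ n) p z)) {z : M} (hz : z ∈ U) :
    scalarCurvature g z = coordScalar G (extChartAt (𝓡∂ n) p z) := by
  have := (isPullback_transition g hU hUp hG hs z).coordScalar_eq
    (y := extChartAt (𝓡∂ n) z z) ⟨mem_extChartAt_target z, by
      rwa [mem_preimage, extChartAt_to_inv]⟩
  rwa [transition_apply_chart (mem_extChartAt_source z)] at this

lemma contDiffWithinAt_comp_symm {u : M → ℝ} (hu : ContMDiff (𝓡∂ n) 𝓘(ℝ, ℝ) ∞ u) {p : M}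
    {y : EuclideanSpace ℝ (Fin n)} (hy : y ∈ (extChartAt (𝓡∂ n) p).target) :
    ContDiffWithinAt ℝ ∞ (u ∘ (extChartAt (𝓡∂ n) p).symm) ℍ y := by
  have h2 := hu.comp_contMDiffOn (contMDiffOn_extChartAt_symm (I := 𝓡∂ n) (n := ∞) p)
  exact (contMDiffOn_iff_contDiffOn.1 h2 y hy).mono_of_mem_nhdsWithin
    (extChartAt_target_mem_nhdsWithin_of_mem hy)

lemma gradSq_eq (g : SmoothMetric n M) {p : M} {u : M → ℝ}
    (hu : ContMDiff (𝓡∂ n) 𝓘(ℝ, ℝ) ∞ u) {z : M} (hz : z ∈ (extChartAt (𝓡∂ n) p).source) :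
    gradSq g u z = coordGradSq (gram g p) (u ∘ (extChartAt (𝓡∂ n) p).symm)
      (extChartAt (𝓡∂ n) p z) := by
  have hp := isPullback_transition g (isOpen_extChartAt_source p) subset_rfl
    (fun _ _ => rfl) (fun w hw => smoothMat_gram g ((extChartAt (𝓡∂ n) p).map_source hw)) z
  have hy : extChartAt (𝓡∂ n) z z ∈ (extChartAt (𝓡∂ n) z).target ∩
      (extChartAt (𝓡∂ n) z).symm ⁻¹' (extChartAt (𝓡∂ n) p).source :=
    ⟨mem_extChartAt_target z, by rwa [mem_preimage, extChartAt_to_inv]⟩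
  have hτ := transition_apply_chart (p := p) (mem_extChartAt_source (I := 𝓡∂ n) z)
  have h1 := hp.coordGradSq_eq (u := u ∘ (extChartAt (𝓡∂ n) p).symm) hy (by
    rw [hτ]
    exact (contDiffWithinAt_comp_symm hu
      ((extChartAt (𝓡∂ n) p).map_source hz)).differentiableWithinAt (by simp))
  rw [hτ] at h1
  rw [← h1]
  have hcongr : (u ∘ (extChartAt (𝓡∂ n) z).symm) =ᶠ[𝓝[ℍ] (extChartAt (𝓡∂ n) z z)]
      fun w => (u ∘ (extChartAt (𝓡∂ n) p).symm) (transition z p w) := by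
    filter_upwards [hp.mem_nhds _ hy] with w hw
    simp only [transition, Function.comp_apply]
    rw [(extChartAt (𝓡∂ n) p).left_inv hw.2]
  have hyS : extChartAt (𝓡∂ n) z z ∈ ℍ := hp.subset hy
  simp only [gradSq, coordGradSq, partialD_congr hyS hcongr]

end Invariance

end ConformalBoundary
end

noncomputable section

namespace ConformalBoundary

open scoped Topology Matrix
open Filter

section PushDensity

/-! ### Gluing measures given by densities in charts -/

variable {F M : Type*} [NormedAddCommGroup F] [NormedSpace ℝ F] [FiniteDimensional ℝ F]
  [MeasurableSpace F] [BorelSpace F] (μ : Measure F) [μ.IsAddHaarMeasure]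
  [TopologicalSpace M] [MeasurableSpace M] [BorelSpace M]

/-- The image under `s` of the measure with density `ρ` on `T`. -/
def pushDensity (T : Set F) (s : F → M) (ρ : F → ℝ) : Measure M :=
  ((μ.restrict T).withDensity fun w => ENNReal.ofReal (ρ w)).map s

variable {μ} {T T' : Set F} {s s' : F → M} {ρ ρ' : F → ℝ} {V B : Set M}

lemma measurableSet_inter_preimage (hT : MeasurableSet T) (hs : ContinuousOn s T)
    (hB : MeasurableSet B) : MeasurableSet (T ∩ s ⁻¹' B) := by
  have h : T ∩ s ⁻¹' B = Subtype.val '' ((T.restrict s) ⁻¹' B) := by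
    ext w
    exact ⟨fun h => ⟨⟨w, h.1⟩, h.2, rfl⟩, by rintro ⟨⟨w, hw⟩, h, rfl⟩; exact ⟨hw, h⟩⟩
  rw [h]
  exact hT.subtype_image ((continuousOn_iff_continuous_restrict.1 hs).measurable hB)

lemma aemeasurable_withDensity_restrict (hT : MeasurableSet T) (hs : ContinuousOn s T) :
    AEMeasurable s ((μ.restrict T).withDensity fun w => ENNReal.ofReal (ρ w)) :=
  (hs.aemeasurable hT).mono_ac (withDensity_absolutelyContinuous _ _)

lemma pushDensity_apply (hT : MeasurableSet T) (hs : ContinuousOn s T) (hB : MeasurableSet B) :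
    pushDensity μ T s ρ B = ∫⁻ w in T ∩ s ⁻¹' B, ENNReal.ofReal (ρ w) ∂μ := by
  rw [pushDensity, Measure.map_apply_of_aemeasurable (aemeasurable_withDensity_restrict hT hs) hB,
    withDensity_apply', Measure.restrict_restrict' hT, inter_comm]

/-- The change of variables formula compares two densities that are related by `β`. -/
lemma pushDensity_le (hT : MeasurableSet T) (hs : ContinuousOn s T) (hinj : InjOn s T)
    (hT' : MeasurableSet T') (hs' : ContinuousOn s' T') {β : F → F} {β' : F → F →L[ℝ] F}
    (hβT : ∀ w ∈ T ∩ s ⁻¹' V, β w ∈ T') (hβs : ∀ w ∈ T ∩ s ⁻¹' V, s' (β w) = s w)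
    (hβ' : ∀ w ∈ T ∩ s ⁻¹' V, HasFDerivWithinAt β (β' w) (T ∩ s ⁻¹' V) w)
    (hρ : ∀ w ∈ T ∩ s ⁻¹' V, ρ w = |(β' w).det| * ρ' (β w))
    (hB : MeasurableSet B) (hBV : B ⊆ V) :
    pushDensity μ T s ρ B ≤ pushDensity μ T' s' ρ' B := by
  rw [pushDensity_apply hT hs hB, pushDensity_apply hT' hs' hB]
  have hsub : T ∩ s ⁻¹' B ⊆ T ∩ s ⁻¹' V := inter_subset_inter_right _ (preimage_mono hBV)
  have hm := measurableSet_inter_preimage hT hs hB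
  calc ∫⁻ w in T ∩ s ⁻¹' B, ENNReal.ofReal (ρ w) ∂μ
      = ∫⁻ w in T ∩ s ⁻¹' B, ENNReal.ofReal |(β' w).det| * ENNReal.ofReal (ρ' (β w)) ∂μ := by
        refine setLIntegral_congr_fun hm fun w hw => ?_
        rw [hρ w (hsub hw), ENNReal.ofReal_mul (abs_nonneg _)]
    _ = ∫⁻ w in β '' (T ∩ s ⁻¹' B), ENNReal.ofReal (ρ' w) ∂μ := by
        refine (lintegral_image_eq_lintegral_abs_det_fderiv_mul μ hm
          (fun w hw => (hβ' w (hsub hw)).mono hsub) ?_ fun w => ENNReal.ofReal (ρ' w)).symm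
        -- `β` is injective because `s' ∘ β = s` and `s` is injective on `T`.
        intro w hw w' hw' h
        refine hinj hw.1 hw'.1 ?_
        rw [← hβs w (hsub hw), ← hβs w' (hsub hw'), h]
    _ ≤ _ := by
        refine lintegral_mono_set ?_
        rintro _ ⟨w, hw, rfl⟩
        refine ⟨hβT w (hsub hw), ?_⟩
        rw [mem_preimage, hβs w (hsub hw)]
        exact hw.2

/-- If one member of a family of measures dominates the others on `V`, it is the supremum there. -/
lemma restrict_iSup_eq {ι : Type*} {ν : ι → Measure M} {p : ι} (hV : MeasurableSet V)
    (h : ∀ x, ∀ B ⊆ V, MeasurableSet B → ν x B ≤ ν p B) :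
    (⨆ x, ν x).restrict V = (ν p).restrict V := by
  refine le_antisymm ?_ (Measure.restrict_mono subset_rfl (le_iSup ν p))
  -- The right-hand side bounds every `ν x`, by domination inside `V` and by the supremum itself
  -- outside; restricting it to `V` removes the second summand.
  have hle : (⨆ x, ν x) ≤ (ν p).restrict V + (⨆ x, ν x).restrict Vᶜ := by
    refine iSup_le fun x => Measure.le_iff.2 fun B hB => ?_
    rw [Measure.add_apply, Measure.restrict_apply hB, Measure.restrict_apply hB,
      ← measure_inter_add_sdiff B hV]
    exact add_le_add (h x _ inter_subset_right (hB.inter hV))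
      (le_iSup ν x (B ∩ Vᶜ))
  refine (Measure.restrict_mono subset_rfl hle).trans ?_
  rw [Measure.restrict_add, Measure.restrict_restrict hV, Measure.restrict_restrict hV]
  simp

/-- On `V` the supremum is `ν p`, a pushforward with density, so the integral can be read in one
chart. No integrability is needed: both sides are the same Bochner integral. -/
lemma integral_iSup_eq {ι : Type*} {ν : ι → Measure M} {p : ι} (hT : MeasurableSet T)
    (hs : ContinuousOn s T) (hsV : MapsTo s T V) (hνp : ν p = pushDensity μ T s ρ)
    (hρ : ContinuousOn ρ T) (hρ0 : ∀ w ∈ T, 0 ≤ ρ w)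
    (hV : MeasurableSet V) (h : ∀ x, ∀ B ⊆ V, MeasurableSet B → ν x B ≤ ν p B)
    {f : M → ℝ} (hf : Measurable f) (hf0 : ∀ z ∉ V, f z = 0) :
    ∫ z, f z ∂(⨆ x, ν x) = ∫ w in T, ρ w * f (s w) ∂μ := by
  have hm := aemeasurable_withDensity_restrict (ρ := ρ) (μ := μ) hT hs
  have hpV : (ν p).restrict V = ν p := by
    refine Measure.restrict_eq_self_of_ae_mem ?_
    rw [ae_iff, hνp]
    change pushDensity μ T s ρ Vᶜ = 0
    rw [pushDensity_apply hT hs hV.compl]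
    have : T ∩ s ⁻¹' Vᶜ = ∅ := by
      ext w
      simp only [mem_inter_iff, mem_preimage, mem_compl_iff, mem_empty_iff_false, iff_false, not_and,
        not_not]
      exact fun hw => hsV hw
    rw [this]
    simp
  rw [← setIntegral_eq_integral_of_forall_compl_eq_zero hf0, restrict_iSup_eq hV h, hpV, hνp,
    pushDensity, integral_map hm hf.aestronglyMeasurable,
    integral_withDensity_eq_integral_toReal_smul₀
      (hρ.aemeasurable hT).ennreal_ofReal (by simp)]
  refine setIntegral_congr_fun hT fun w hw => ?_
  simp [ENNReal.toReal_ofReal (hρ0 w hw)]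

end PushDensity

end ConformalBoundary
end

noncomputable section

namespace ConformalBoundary

open scoped Topology Matrix
open Filter

section Boundary

variable {n : ℕ} [NeZero n]

local notation "𝔼" => EuclideanSpace ℝ (Fin n)
local notation "ℍ" => range (𝓡∂ n)

/-! ### The boundary hyperplane -/

lemma boundaryIncl_apply_zero (w : EuclideanSpace ℝ {i : Fin n // i ≠ 0}) :
    boundaryIncl w 0 = 0 := by
  simp [boundaryIncl]

lemma boundaryIncl_apply (w : EuclideanSpace ℝ {i : Fin n // i ≠ 0}) (i : {i : Fin n // i ≠ 0}) :
    boundaryIncl w i = w i := by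
  simp [boundaryIncl, i.2]

/-- The inclusion of the boundary hyperplane as a continuous linear map. -/
def boundaryInclL : EuclideanSpace ℝ {i : Fin n // i ≠ 0} →L[ℝ] EuclideanSpace ℝ (Fin n) :=
  LinearMap.toContinuousLinearMap
    { toFun := boundaryIncl
      map_add' := fun v w => by
        ext i
        by_cases h : i = 0 <;> simp [boundaryIncl, h]
      map_smul' := fun c w => by
        ext i
        by_cases h : i = 0 <;> simp [boundaryIncl, h] }

lemma boundaryInclL_apply (w : EuclideanSpace ℝ {i : Fin n // i ≠ 0}) :
    boundaryInclL w = boundaryIncl w := rfl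

lemma continuous_boundaryIncl : Continuous (boundaryIncl (n := n)) :=
  (boundaryInclL (n := n)).continuous

lemma boundaryIncl_single (i : {i : Fin n // i ≠ 0}) :
    boundaryIncl (EuclideanSpace.single i (1 : ℝ)) = EuclideanSpace.single (i : Fin n) 1 := by
  ext j
  by_cases h : j = 0
  · subst h
    simp [boundaryIncl, Pi.single_apply, i.2.symm]
  · simp [boundaryIncl, h, Pi.single_apply, Subtype.ext_iff]

lemma injective_boundaryIncl : Function.Injective (boundaryIncl (n := n)) := fun v w h => by
  ext i
  rw [← boundaryIncl_apply v i, h, boundaryIncl_apply]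

lemma boundaryIncl_mem_halfSpace (w : EuclideanSpace ℝ {i : Fin n // i ≠ 0}) :
    boundaryIncl w ∈ ℍ := by
  rw [range_modelWithCornersEuclideanHalfSpace, mem_setOf_eq, boundaryIncl_apply_zero]

/-- The projection to the boundary hyperplane. -/
def boundaryProj : EuclideanSpace ℝ (Fin n) →L[ℝ] EuclideanSpace ℝ {i : Fin n // i ≠ 0} :=
  LinearMap.toContinuousLinearMap
    { toFun := fun y => WithLp.toLp 2 fun i => y i
      map_add' := fun v w => rfl
      map_smul' := fun c w => rfl }

lemma boundaryProj_apply (y : EuclideanSpace ℝ (Fin n)) (i : {i : Fin n // i ≠ 0}) :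
    boundaryProj y i = y i := rfl

lemma boundaryIncl_boundaryProj {y : EuclideanSpace ℝ (Fin n)} (hy : y 0 = 0) :
    boundaryIncl (boundaryProj y) = y := by
  ext i
  by_cases h : i = 0
  · rw [h, boundaryIncl_apply_zero, hy]
  · exact boundaryIncl_apply _ ⟨i, h⟩

lemma sum_eq_sum_ne_zero {h : Fin n → ℝ} (h0 : h 0 = 0) :
    ∑ a, h a = ∑ a : {i : Fin n // i ≠ 0}, h a := by
  rw [← Finset.sum_subtype (Finset.univ.filter fun i : Fin n => i ≠ 0) (by simp) h,
    Finset.sum_filter]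
  refine Finset.sum_congr rfl fun a _ => ?_
  by_cases ha : a = 0 <;> simp [ha, h0]

/-- A change of coordinates preserving the hyperplane has no normal component on tangential vectors,
so the index `0` drops out of the matrix products. -/
lemma tangentialGram_pullback {J G : Matrix (Fin n) (Fin n) ℝ} (hJ : ∀ i, i ≠ 0 → J 0 i = 0) :
    tangentialGram (Jᵀ * G * J) = (tangentialGram J)ᵀ * tangentialGram G * tangentialGram J := by
  ext i j
  simp only [tangentialGram, Matrix.submatrix_apply, Matrix.mul_apply, Matrix.transpose_apply]
  rw [sum_eq_sum_ne_zero (by rw [hJ _ j.2, mul_zero])]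
  refine Finset.sum_congr rfl fun b _ => ?_
  rw [sum_eq_sum_ne_zero (by rw [hJ _ i.2, zero_mul])]

lemma sqrt_det_pullback {ι : Type*} [Fintype ι] [DecidableEq ι] (J G : Matrix ι ι ℝ) :
    √(Jᵀ * G * J).det = |J.det| * √G.det := by
  rw [Matrix.det_mul, Matrix.det_mul, Matrix.det_transpose,
    show J.det * G.det * J.det = J.det ^ 2 * G.det by ring, Real.sqrt_mul (sq_nonneg _),
    Real.sqrt_sq_eq_abs]

end Boundary

section ChartMeasure

variable {n : ℕ} [NeZero n] {M : Type*} [TopologicalSpace M]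
  [ChartedSpace (EuclideanHalfSpace n) M] [IsManifold (𝓡∂ n) ∞ M]

local notation "ℍ" => range (𝓡∂ n)

/-! ### Integration in a chart -/

lemma measurableSet_extChartAt_target (p : M) : MeasurableSet (extChartAt (𝓡∂ n) p).target := by
  rw [extChartAt_target]
  exact (((chartAt (EuclideanHalfSpace n) p).open_target.preimage
    (𝓡∂ n).continuous_symm).measurableSet).inter (𝓡∂ n).isClosed_range.measurableSet

lemma hasFDerivWithinAt_transition {x p : M} {y : EuclideanSpace ℝ (Fin n)}
    (hy : y ∈ transitionDomain x p) :
    HasFDerivWithinAt (transition x p) (fderivWithin ℝ (transition x p) ℍ y) ℍ y :=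
  ((contDiffWithinAt_transition hy).differentiableWithinAt (by simp)).hasFDerivWithinAt

lemma jac_transition_eq {x p : M} {y : EuclideanSpace ℝ (Fin n)}
    (hy : y ∈ transitionDomain x p) (a i : Fin n) :
    jac (transition x p) y a i =
      fderivWithin ℝ (transition x p) ℍ y (EuclideanSpace.single i 1) a :=
  jac_apply _ (extChartAt_target_subset_range x hy.1)
    (hasFDerivWithinAt_transition hy).differentiableWithinAt a i

lemma det_fderivWithin_transition {x p : M} {y : EuclideanSpace ℝ (Fin n)}
    (hy : y ∈ transitionDomain x p) :
    (fderivWithin ℝ (transition x p) ℍ y).det = (jac (transition x p) y).det := by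
  rw [ContinuousLinearMap.det,
    ← LinearMap.det_toMatrix (EuclideanSpace.basisFun (Fin n) ℝ).toBasis]
  congr 1
  ext a i
  rw [jac_transition_eq hy, LinearMap.toMatrix_apply]
  simp

/-- Interior points are recognized equally in every chart, which is why transition maps preserve the
hyperplane `y 0 = 0`. -/
lemma isBoundaryPoint_iff_apply_zero {p z : M} (hz : z ∈ (extChartAt (𝓡∂ n) p).source) :
    (𝓡∂ n).IsBoundaryPoint z ↔ extChartAt (𝓡∂ n) p z 0 = 0 := by
  have hz' : z ∈ (chartAt (EuclideanHalfSpace n) p).source := by rwa [extChartAt_source] at hz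
  have hrange : extChartAt (𝓡∂ n) p z ∈ ℍ :=
    extChartAt_target_subset_range p ((extChartAt (𝓡∂ n) p).map_source hz)
  rw [range_modelWithCornersEuclideanHalfSpace, mem_setOf_eq] at hrange
  have key : (𝓡∂ n).IsInteriorPoint z ↔ 0 < extChartAt (𝓡∂ n) p z 0 := by
    rw [(𝓡∂ n).isInteriorPoint_iff_of_mem_atlas (n := ∞) (by simp) (chart_mem_atlas _ p) hz']
    have hint := interior_range_modelWithCornersEuclideanHalfSpace n
    constructor
    · intro h
      have := OpenPartialHomeomorph.interior_extend_target_subset_interior_range _ h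
      rw [hint] at this
      exact this
    · intro h
      refine (chartAt (EuclideanHalfSpace n) p).mem_interior_extend_target
        ((chartAt (EuclideanHalfSpace n) p).map_source hz') ?_
      rw [hint]
      exact h
  rw [(𝓡∂ n).isBoundaryPoint_iff_not_isInteriorPoint, key, not_lt]
  exact ⟨fun h => le_antisymm h hrange, fun h => h.le⟩

lemma transition_apply_zero {x p : M} {y : EuclideanSpace ℝ (Fin n)}
    (hy : y ∈ transitionDomain x p) (h0 : y 0 = 0) : transition x p y 0 = 0 := by
  rw [transition, Function.comp_apply, ← isBoundaryPoint_iff_apply_zero hy.2,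
    isBoundaryPoint_iff_apply_zero ((extChartAt (𝓡∂ n) x).map_target hy.1),
    (extChartAt (𝓡∂ n) x).right_inv hy.1, h0]

lemma hasFDerivAt_transition_boundaryIncl {x p : M} {w : EuclideanSpace ℝ {i : Fin n // i ≠ 0}}
    (hw : boundaryIncl w ∈ transitionDomain x p) :
    HasFDerivAt (fun w => transition x p (boundaryIncl w))
      ((fderivWithin ℝ (transition x p) ℍ (boundaryIncl w)).comp boundaryInclL) w := by
  rw [← hasFDerivWithinAt_univ]
  exact (hasFDerivWithinAt_transition hw).comp w
    (boundaryInclL (n := n)).hasFDerivAt.hasFDerivWithinAt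
    (fun v _ => boundaryIncl_mem_halfSpace v)

/-- The normal component of the transition map vanishes identically along the hyperplane near the
point, so its tangential derivatives vanish. -/
lemma jac_transition_zero_apply {x p : M} {w : EuclideanSpace ℝ {i : Fin n // i ≠ 0}}
    (hw : boundaryIncl w ∈ transitionDomain x p) {i : Fin n} (hi : i ≠ 0) :
    jac (transition x p) (boundaryIncl w) 0 i = 0 := by
  have h1 := (EuclideanSpace.proj (0 : Fin n) : EuclideanSpace ℝ (Fin n) →L[ℝ] ℝ).hasFDerivAt.comp w
    (hasFDerivAt_transition_boundaryIncl hw)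
  have hev : ∀ᶠ v in 𝓝 w, boundaryIncl v ∈ transitionDomain x p :=
    (tendsto_nhdsWithin_iff.2 ⟨continuous_boundaryIncl.continuousAt,
      Eventually.of_forall boundaryIncl_mem_halfSpace⟩).eventually
        ((coordChange_transition x p).mem_nhds _ hw)
  have h2 := h1.congr_of_eventuallyEq (f₁ := fun _ => (0 : ℝ)) (by
    filter_upwards [hev] with v hv
    exact (transition_apply_zero hv (boundaryIncl_apply_zero v)).symm)
  have h3 := congrArg (fun A => A (EuclideanSpace.single ⟨i, hi⟩ (1 : ℝ)))
    (h2.unique (hasFDerivAt_const (0 : ℝ) w))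
  simp only [ContinuousLinearMap.comp_apply, ContinuousLinearMap.zero_apply, boundaryInclL_apply,
    boundaryIncl_single] at h3
  rw [jac_transition_eq hw]
  exact h3

variable [MeasurableSpace M] [BorelSpace M]

/-- Change of variables along the transition map: the Jacobian determinant is exactly the factor
relating the two densities `√det`. -/
lemma chartVolume_le (g : SmoothMetric n M) (x p : M) {B : Set M}
    (hBp : B ⊆ (extChartAt (𝓡∂ n) p).source) (hB : MeasurableSet B) :
    chartVolume g x B ≤ chartVolume g p B := by
  refine pushDensity_le (μ := volume) (V := (extChartAt (𝓡∂ n) p).source)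
    (ρ := fun y => √(gram g x y).det) (ρ' := fun y => √(gram g p y).det)
    (measurableSet_extChartAt_target x)
    (continuousOn_extChartAt_symm x) (extChartAt (𝓡∂ n) x).symm.injOn
    (measurableSet_extChartAt_target p) (continuousOn_extChartAt_symm p)
    (β := transition x p) (β' := fun y => fderivWithin ℝ (transition x p) ℍ y)
    (fun y hy => (extChartAt (𝓡∂ n) p).map_source hy.2)
    (fun y hy => (extChartAt (𝓡∂ n) p).left_inv hy.2)
    (fun y hy => (hasFDerivWithinAt_transition hy).mono (coordChange_transition x p).subset)
    (fun y hy => ?_) hB hBp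
  rw [gram_transition g hy, sqrt_det_pullback, det_fderivWithin_transition hy]

lemma chartBoundaryVolume_eq (g : SmoothMetric n M) (x : M) :
    chartBoundaryVolume g x = pushDensity volume (boundaryIncl ⁻¹' (extChartAt (𝓡∂ n) x).target)
      (fun w => (extChartAt (𝓡∂ n) x).symm (boundaryIncl w))
      (fun w => √(tangentialGram (gram g x (boundaryIncl w))).det) := rfl

lemma measurableSet_boundary_target (x : M) :
    MeasurableSet (boundaryIncl ⁻¹' (extChartAt (𝓡∂ n) x).target) :=
  continuous_boundaryIncl.measurable (measurableSet_extChartAt_target x)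

lemma continuousOn_boundary_symm (x : M) :
    ContinuousOn (fun w => (extChartAt (𝓡∂ n) x).symm (boundaryIncl w))
      (boundaryIncl ⁻¹' (extChartAt (𝓡∂ n) x).target) :=
  (continuousOn_extChartAt_symm x).comp continuous_boundaryIncl.continuousOn fun _ hw => hw

lemma chartBoundaryVolume_le (g : SmoothMetric n M) (x p : M) {B : Set M}
    (hBp : B ⊆ (extChartAt (𝓡∂ n) p).source) (hB : MeasurableSet B) :
    chartBoundaryVolume g x B ≤ chartBoundaryVolume g p B := by
  rw [chartBoundaryVolume_eq, chartBoundaryVolume_eq]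
  have hz : ∀ w : EuclideanSpace ℝ {i : Fin n // i ≠ 0}, boundaryIncl w ∈ transitionDomain x p →
      boundaryIncl (boundaryProj (transition x p (boundaryIncl w))) =
        transition x p (boundaryIncl w) := fun w hw =>
    boundaryIncl_boundaryProj (transition_apply_zero hw (boundaryIncl_apply_zero w))
  refine pushDensity_le (V := (extChartAt (𝓡∂ n) p).source)
    (measurableSet_boundary_target x) (continuousOn_boundary_symm x)
    ((extChartAt (𝓡∂ n) x).symm.injOn.comp injective_boundaryIncl.injOn fun _ hw => hw)
    (measurableSet_boundary_target p) (continuousOn_boundary_symm p)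
    (β := fun w => boundaryProj (transition x p (boundaryIncl w)))
    (β' := fun w => boundaryProj.comp
      ((fderivWithin ℝ (transition x p) ℍ (boundaryIncl w)).comp boundaryInclL))
    (fun w hw => ?_) (fun w hw => ?_)
    (fun w hw => (boundaryProj.hasFDerivAt.comp w
      (hasFDerivAt_transition_boundaryIncl hw)).hasFDerivWithinAt)
    (fun w hw => ?_) hB hBp
  · rw [mem_preimage, hz w hw]
    exact (extChartAt (𝓡∂ n) p).map_source hw.2
  · rw [hz w hw]
    exact (extChartAt (𝓡∂ n) p).left_inv hw.2
  · rw [hz w hw, gram_transition g hw, tangentialGram_pullback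
      fun i hi => jac_transition_zero_apply hw hi, sqrt_det_pullback]
    congr 2
    rw [ContinuousLinearMap.det, ← LinearMap.det_toMatrix
      (EuclideanSpace.basisFun {i : Fin n // i ≠ 0} ℝ).toBasis]
    congr 1
    ext a i
    rw [tangentialGram, Matrix.submatrix_apply, jac_transition_eq hw, LinearMap.toMatrix_apply,
      ← boundaryIncl_single]
    simp [boundaryInclL_apply, boundaryProj_apply]

lemma continuousOn_gram_apply (g : SmoothMetric n M) (p : M) (i j : Fin n) :
    ContinuousOn (fun y => gram g p y i j) (extChartAt (𝓡∂ n) p).target := fun y hy =>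
  (smoothMat_gram g hy i j).continuousWithinAt.mono (extChartAt_target_subset_range p)

lemma integral_riemannianVolume (g : SmoothMetric n M) (p : M) {f : M → ℝ} (hf : Measurable f)
    (hf0 : ∀ z ∉ (extChartAt (𝓡∂ n) p).source, f z = 0) :
    ∫ z, f z ∂(riemannianVolume g) = ∫ y in (extChartAt (𝓡∂ n) p).target,
      √(gram g p y).det * f ((extChartAt (𝓡∂ n) p).symm y) := by
  refine integral_iSup_eq (ν := chartVolume g) (p := p) (measurableSet_extChartAt_target p)
    (continuousOn_extChartAt_symm p) (extChartAt (𝓡∂ n) p).symm.mapsTo rfl ?_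
    (fun _ _ => Real.sqrt_nonneg _) (isOpen_extChartAt_source p).measurableSet
    (fun x B hBp hB => chartVolume_le g x p hBp hB) hf hf0
  refine Real.continuous_sqrt.comp_continuousOn ?_
  simp only [Matrix.det_apply]
  exact continuousOn_finsetSum _ fun σ _ => (continuousOn_finsetProd _ fun i _ =>
    continuousOn_gram_apply g p _ _).const_smul _

lemma integral_boundaryVolume (g : SmoothMetric n M) (p : M) {f : M → ℝ} (hf : Measurable f)
    (hf0 : ∀ z ∉ (extChartAt (𝓡∂ n) p).source, f z = 0) :
    ∫ z, f z ∂(boundaryVolume g) = ∫ w in boundaryIncl ⁻¹' (extChartAt (𝓡∂ n) p).target,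
      √(tangentialGram (gram g p (boundaryIncl w))).det *
        f ((extChartAt (𝓡∂ n) p).symm (boundaryIncl w)) := by
  refine integral_iSup_eq (ν := chartBoundaryVolume g) (p := p) (measurableSet_boundary_target p)
    (continuousOn_boundary_symm p) (fun w hw => (extChartAt (𝓡∂ n) p).map_target hw)
    (chartBoundaryVolume_eq g p) ?_
    (fun _ _ => Real.sqrt_nonneg _) (isOpen_extChartAt_source p).measurableSet
    (fun x B hBp hB => chartBoundaryVolume_le g x p hBp hB) hf hf0
  refine Real.continuous_sqrt.comp_continuousOn ?_
  simp only [Matrix.det_apply]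
  exact continuousOn_finsetSum _ fun σ _ => (continuousOn_finsetProd _ fun i _ =>
    (continuousOn_gram_apply g p _ _).comp continuous_boundaryIncl.continuousOn
      fun _ hw => hw).const_smul _

/-- Within the chart domain the boundary measure is the image of a measure on `y 0 = 0`, so a set
avoiding that hyperplane has empty preimage. -/
lemma boundaryVolume_eq_zero (g : SmoothMetric n M) (p : M) {B : Set M}
    (hBp : B ⊆ (extChartAt (𝓡∂ n) p).source) (hB : MeasurableSet B)
    (h0 : ∀ z ∈ B, extChartAt (𝓡∂ n) p z 0 ≠ 0) : boundaryVolume g B = 0 := by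
  have h := restrict_iSup_eq (ν := chartBoundaryVolume g) (p := p)
    (isOpen_extChartAt_source (I := 𝓡∂ n) p).measurableSet
    (fun x B hBp hB => chartBoundaryVolume_le g x p hBp hB)
  have h' := congrArg (fun ν => ν B) h
  simp only [Measure.restrict_apply hB, inter_eq_left.2 hBp] at h'
  rw [boundaryVolume, h', chartBoundaryVolume_eq, pushDensity_apply
    (measurableSet_boundary_target p) (continuousOn_boundary_symm p) hB]
  have : boundaryIncl ⁻¹' (extChartAt (𝓡∂ n) p).target ∩
      (fun w => (extChartAt (𝓡∂ n) p).symm (boundaryIncl w)) ⁻¹' B = ∅ := by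
    refine eq_empty_of_forall_notMem fun w hw => h0 _ hw.2 ?_
    rw [(extChartAt (𝓡∂ n) p).right_inv hw.1, boundaryIncl_apply_zero]
  rw [this]
  simp

end ChartMeasure

end ConformalBoundary
end

noncomputable section

namespace ConformalBoundary

open scoped Topology Matrix
open Filter

section Model

variable {n : ℕ} [NeZero n]

local notation "ℍ" => range (𝓡∂ n)

/-! ### A metric of constant negative scalar curvature in a chart -/

lemma exists_weights (hn : 3 ≤ n) : ∃ ε : Fin n → ℝ, (∀ i, |ε i| ≤ 1) ∧ ε 0 = 0 ∧
    ∑ i, ε i = 0 ∧ ∑ i, ε i ^ 2 = 2 := by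
  have hv : ((0 : Fin n) : ℕ) = 0 := rfl
  let j : Fin n := ⟨1, by omega⟩
  let k : Fin n := ⟨2, by omega⟩
  have hjk : j ≠ k := by simp [j, k, Fin.ext_iff]
  have hj : (0 : Fin n) ≠ j := by rw [Ne, Fin.ext_iff, hv]; simp [j]
  have hk : (0 : Fin n) ≠ k := by rw [Ne, Fin.ext_iff, hv]; simp [k]
  have hsq : ∀ i, ((if i = j then 1 else 0) - if i = k then 1 else 0 : ℝ) ^ 2 =
      (if i = j then 1 else 0) + if i = k then 1 else 0 := by
    intro i
    by_cases h1 : i = j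
    · subst h1
      simp [hjk]
    · simp [h1]
  -- Weight `1` on direction `1`, weight `-1` on direction `2`, and `0` elsewhere, including the
  -- normal direction.
  refine ⟨fun i => (if i = j then 1 else 0) - if i = k then 1 else 0, fun i => ?_, ?_, ?_, ?_⟩
  · simp only
    split_ifs <;> simp
  · simp [hj, hk]
  · simp [Finset.sum_sub_distrib]
  · simp only [hsq, Finset.sum_add_distrib]
    norm_num

variable {M : Type*} [TopologicalSpace M]
  [ChartedSpace (EuclideanHalfSpace n) M] [IsManifold (𝓡∂ n) ∞ M]

lemma contDiff_smul_const {E W : Type*} [NormedAddCommGroup E] [NormedSpace ℝ E]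
    [NormedAddCommGroup W] [NormedSpace ℝ W] {d : E → ℝ} (hd : ContDiff ℝ ∞ d) (B : W) :
    ContDiff ℝ ∞ fun y => d y • B :=
  hd.smul contDiff_const

lemma exists_gram_eq_expMetric [CompactSpace M] [T2Space M] (p : M) {K : Set M} (hK : IsClosed K)
    (hKp : K ⊆ (extChartAt (𝓡∂ n) p).source) (κ : ℝ) (ε : Fin n → ℝ) {C : Fin n → ℝ}
    (hC : ∀ i, 0 < C i) (a : Fin n) : ∃ g : SmoothMetric n M, ∀ z ∈ K,
      gram g p (extChartAt (𝓡∂ n) p z) = expMetric κ ε C a (extChartAt (𝓡∂ n) p z) := by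
  let d : Fin n → EuclideanSpace ℝ (Fin n) → ℝ := fun i y => C i * Real.exp (2 * κ * ε i * y a)
  have hd : ∀ i y, 0 < d i y := fun i y => mul_pos (hC i) (Real.exp_pos _)
  let q : Fin n → EuclideanSpace ℝ (Fin n) →L[ℝ] ℝ := fun i => EuclideanSpace.proj i
  let b : EuclideanSpace ℝ (Fin n) →
      EuclideanSpace ℝ (Fin n) →L[ℝ] EuclideanSpace ℝ (Fin n) →L[ℝ] ℝ :=
    fun y => ∑ i, d i y • (q i).smulRight (q i)
  have hb : ∀ y v w, b y v w = ∑ i, d i y * (v i * w i) := by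
    intro y v w
    simp [b, q, ContinuousLinearMap.sum_apply, mul_assoc]
  have hbs : ContDiff ℝ ∞ b := by
    refine ContDiff.sum fun i _ => ?_
    have hdi : ContDiff ℝ ∞ (d i) :=
      contDiff_const.mul (Real.contDiff_exp.comp (contDiff_const.mul (q a).contDiff))
    exact contDiff_smul_const (W := EuclideanSpace ℝ (Fin n) →L[ℝ] EuclideanSpace ℝ (Fin n) →L[ℝ] ℝ)
      hdi _
  obtain ⟨g, hg⟩ := exists_metric_eq_on p hK hKp b hbs
    (fun y v w => by rw [hb, hb]; exact Finset.sum_congr rfl fun i _ => by ring)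
    (fun y v hv => by
      rw [hb]
      obtain ⟨i, hi⟩ : ∃ i, v i ≠ 0 := by
        by_contra! h
        exact hv (by ext i; simpa using h i)
      exact Finset.sum_pos' (fun i _ => mul_nonneg (hd i y).le (mul_self_nonneg _))
        ⟨i, Finset.mem_univ _, mul_pos (hd i y) (mul_self_pos.2 hi)⟩)
  refine ⟨g, fun z hz => ?_⟩
  ext i j
  rw [hg z hz, hb, expMetric_apply]
  by_cases h : i = j <;> simp [d, Pi.single_apply, h, eq_comm]

lemma det_expMetric {κ : ℝ} {ε C : Fin n → ℝ} {a : Fin n} (hsum : ∑ i, ε i = 0)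
    (y : EuclideanSpace ℝ (Fin n)) : (expMetric κ ε C a y).det = ∏ i, C i := by
  rw [expMetric, Matrix.det_diagonal, Finset.prod_mul_distrib, ← Real.exp_sum]
  have : ∑ i, 2 * κ * ε i * y a = 0 := by
    rw [← Finset.sum_mul, ← Finset.mul_sum, hsum, mul_zero, zero_mul]
  rw [this, Real.exp_zero, mul_one]

lemma smoothMat_expMetric (κ : ℝ) (ε C : Fin n → ℝ) (a : Fin n) (y : EuclideanSpace ℝ (Fin n)) :
    SmoothMat (expMetric κ ε C a) y := fun i j =>
  (contDiff_expMetric_apply i j).contDiffAt.contDiffWithinAt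

/-- The energy density of `v` for the metric `expMetric κ ε C 0`, when `∑ i, ε i ^ 2 = 2`. -/
def modelDensity (c κ : ℝ) (ε C : Fin n → ℝ) (v : EuclideanSpace ℝ (Fin n) → ℝ)
    (y : EuclideanSpace ℝ (Fin n)) : ℝ :=
  c * ∑ i, (C i * Real.exp (2 * κ * ε i * y 0))⁻¹ * fderiv ℝ v y (EuclideanSpace.single i 1) ^ 2
    - 2 * κ ^ 2 * v y ^ 2

lemma continuous_fderiv_single {v : EuclideanSpace ℝ (Fin n) → ℝ} (hv : ContDiff ℝ ∞ v)
    (i : Fin n) : Continuous fun y => fderiv ℝ v y (EuclideanSpace.single i 1) :=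
  (hv.continuous_fderiv (by simp)).clm_apply continuous_const

lemma continuous_modelDensity (c κ : ℝ) (ε : Fin n → ℝ) {C : Fin n → ℝ} (hC : ∀ i, 0 < C i)
    {v : EuclideanSpace ℝ (Fin n) → ℝ} (hv : ContDiff ℝ ∞ v) :
    Continuous (modelDensity c κ ε C v) := by
  refine (continuous_const.mul (continuous_finsetSum _ fun i _ => Continuous.mul ?_
    ((continuous_fderiv_single hv i).pow 2))).sub (continuous_const.mul (hv.continuous.pow 2))
  refine Continuous.inv₀ ?_ fun y => (mul_pos (hC i) (Real.exp_pos _)).ne'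
  exact continuous_const.mul (Real.continuous_exp.comp (continuous_const.mul
    (EuclideanSpace.proj (0 : Fin n) : EuclideanSpace ℝ (Fin n) →L[ℝ] ℝ).continuous))

lemma partialD_eq_fderiv {v : EuclideanSpace ℝ (Fin n) → ℝ} {y : EuclideanSpace ℝ (Fin n)}
    (hv : ContDiff ℝ ∞ v) (hy : y ∈ ℍ) (i : Fin n) :
    partialD i v y = fderiv ℝ v y (EuclideanSpace.single i 1) := by
  rw [partialD, (hv.differentiable (by simp) y).fderivWithin (uniqueDiffWithinAt_halfSpace hy)]

/-- Covers points outside the support of the test function, where the metric is not of model form.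
-/
lemma gradSq_eq_zero (g : SmoothMetric n M) {u : M → ℝ} {z : M} (hu : u =ᶠ[𝓝 z] 0) :
    gradSq g u z = 0 := by
  have hz : extChartAt (𝓡∂ n) z z ∈ ℍ := extChartAt_target_subset_range z (mem_extChartAt_target z)
  have h : u ∘ (extChartAt (𝓡∂ n) z).symm =ᶠ[𝓝[ℍ] (extChartAt (𝓡∂ n) z z)] fun _ => 0 := by
    have hu' : ∀ᶠ w in 𝓝 ((extChartAt (𝓡∂ n) z).symm (extChartAt (𝓡∂ n) z z)), u w = 0 := by
      rw [extChartAt_to_inv]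
      exact hu
    exact nhdsWithin_le_nhds ((continuousAt_extChartAt_symm z).eventually hu')
  simp only [gradSq, coordGradSq, partialD_congr hz h, partialD_const, mul_zero,
    Finset.sum_const_zero]

end Model

end ConformalBoundary
end

noncomputable section

namespace ConformalBoundary

open scoped Topology Matrix
open Filter

section TestFunction

variable {n : ℕ} [NeZero n] {M : Type*} [TopologicalSpace M]
  [ChartedSpace (EuclideanHalfSpace n) M] [IsManifold (𝓡∂ n) ∞ M]

local notation "ℍ" => range (𝓡∂ n)

/-! ### Integrals of functions supported where the metric is of model form -/

variable {g : SmoothMetric n M} {p : M} {U : Set M} {κ : ℝ} {ε C : Fin n → ℝ} {u : M → ℝ}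
  {v : EuclideanSpace ℝ (Fin n) → ℝ}

lemma eventually_eq_zero_of_notMem_tsupport
    (huv : ∀ y ∈ (extChartAt (𝓡∂ n) p).target, u ((extChartAt (𝓡∂ n) p).symm y) = v y)
    {z : M} (hz : z ∈ (extChartAt (𝓡∂ n) p).source) (hzu : z ∉ tsupport u) :
    v =ᶠ[𝓝[ℍ] (extChartAt (𝓡∂ n) p z)] fun _ => 0 := by
  have hm := mem_nhds_preimage_symm (n := n) (x := p) (isClosed_tsupport u).isOpen_compl
    ((extChartAt (𝓡∂ n) p).map_source hz)
    (by rw [(extChartAt (𝓡∂ n) p).left_inv hz]; exact hzu)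
  filter_upwards [hm] with y hy
  rw [← huv y hy.1]
  exact image_eq_zero_of_notMem_tsupport hy.2

/-- On the support of `u` the metric is the model, with curvature `-2 κ²`. Elsewhere in the chart
both sides vanish, so the identity holds on the whole chart domain although the metric is controlled
only on `U`. -/
lemma energyDensity_eq (c : ℝ) (hU : IsOpen U) (hUp : U ⊆ (extChartAt (𝓡∂ n) p).source)
    (hG : ∀ z ∈ U, gram g p (extChartAt (𝓡∂ n) p z) = expMetric κ ε C 0 (extChartAt (𝓡∂ n) p z))
    (hC : ∀ i, 0 < C i) (hC0 : C 0 = 1) (hε : ε 0 = 0) (hsum : ∑ i, ε i = 0)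
    (hsq : ∑ i, ε i ^ 2 = 2) (hu : ContMDiff (𝓡∂ n) 𝓘(ℝ, ℝ) ∞ u) (hsupp : tsupport u ⊆ U)
    (hv : ContDiff ℝ ∞ v)
    (huv : ∀ y ∈ (extChartAt (𝓡∂ n) p).target, u ((extChartAt (𝓡∂ n) p).symm y) = v y)
    {z : M} (hz : z ∈ (extChartAt (𝓡∂ n) p).source) :
    c * gradSq g u z + scalarCurvature g z * u z ^ 2 =
      modelDensity c κ ε C v (extChartAt (𝓡∂ n) p z) := by
  have hy : extChartAt (𝓡∂ n) p z ∈ (extChartAt (𝓡∂ n) p).target :=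
    (extChartAt (𝓡∂ n) p).map_source hz
  have hyH : extChartAt (𝓡∂ n) p z ∈ ℍ := extChartAt_target_subset_range p hy
  have huz : u z = v (extChartAt (𝓡∂ n) p z) := by
    rw [← huv _ hy, (extChartAt (𝓡∂ n) p).left_inv hz]
  by_cases hzu : z ∈ tsupport u
  · have hcongr : u ∘ (extChartAt (𝓡∂ n) p).symm =ᶠ[𝓝[ℍ] (extChartAt (𝓡∂ n) p z)] v := by
      filter_upwards [extChartAt_target_mem_nhdsWithin_of_mem hy] with y hy
      exact huv y hy
    rw [gradSq_eq g hu hz, scalarCurvature_eq g hU hUp hG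
      (fun w _ => smoothMat_expMetric κ ε C 0 _) (hsupp hzu),
      coordScalar_expMetric (fun i => (hC i).ne') hC0 hε hsum hyH, hsq, huz, modelDensity,
      coordGradSq, hG z (hsupp hzu), expMetric_inv fun i => (hC i).ne']
    simp only [partialD_congr hyH hcongr, partialD_eq_fderiv hv hyH, Matrix.diagonal_apply,
      ite_mul, zero_mul, Finset.sum_ite_eq, Finset.mem_univ, if_true]
    have : ∀ i : Fin n, (C i * Real.exp (2 * κ * ε i * extChartAt (𝓡∂ n) p z 0))⁻¹ *
        fderiv ℝ v (extChartAt (𝓡∂ n) p z) (EuclideanSpace.single i 1) *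
        fderiv ℝ v (extChartAt (𝓡∂ n) p z) (EuclideanSpace.single i 1) =
        (C i * Real.exp (2 * κ * ε i * extChartAt (𝓡∂ n) p z 0))⁻¹ *
        fderiv ℝ v (extChartAt (𝓡∂ n) p z) (EuclideanSpace.single i 1) ^ 2 := fun i => by ring
    simp only [this]
    ring
  · have hv0 := eventually_eq_zero_of_notMem_tsupport huv hz hzu
    have hu0 : u z = 0 := image_eq_zero_of_notMem_tsupport hzu
    -- At a boundary point `v` is known to vanish only on the half space side; since `v` is smooth,
    -- the one-sided derivative determines the full one.
    have hD : ∀ i, fderiv ℝ v (extChartAt (𝓡∂ n) p z) (EuclideanSpace.single i 1) = 0 := by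
      intro i
      rw [← partialD_eq_fderiv hv hyH, partialD_congr hyH hv0, partialD_const]
    rw [gradSq_eq_zero g (notMem_tsupport_iff_eventuallyEq.1 hzu), modelDensity, ← huz, hu0]
    simp only [hD]
    simp

variable [MeasurableSpace M] [BorelSpace M]

/-- Curvature and gradient are defined with a chart varying from point to point, so measurability is
obtained from agreement with a continuous function of one fixed chart. -/
lemma measurable_of_eq_comp_chart {F : M → ℝ} {q : EuclideanSpace ℝ (Fin n) → ℝ}
    (hq : Continuous q)
    (hF : ∀ z ∈ (extChartAt (𝓡∂ n) p).source, F z = q (extChartAt (𝓡∂ n) p z))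
    (hF0 : ∀ z ∉ (extChartAt (𝓡∂ n) p).source, F z = 0) : Measurable F := by
  classical
  have h : F = (extChartAt (𝓡∂ n) p).source.piecewise (q ∘ extChartAt (𝓡∂ n) p) 0 := by
    ext z
    by_cases hz : z ∈ (extChartAt (𝓡∂ n) p).source
    · rw [piecewise_eq_of_mem _ _ _ hz, hF z hz, Function.comp_apply]
    · rw [piecewise_eq_of_notMem _ _ _ hz, hF0 z hz, Pi.zero_apply]
  rw [h]
  exact (hq.comp_continuousOn (continuousOn_extChartAt p)).measurable_piecewise
    continuousOn_const (isOpen_extChartAt_source p).measurableSet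

lemma integral_riemannianVolume_eq {F : M → ℝ} {q : EuclideanSpace ℝ (Fin n) → ℝ}
    (hG : ∀ z ∈ U, gram g p (extChartAt (𝓡∂ n) p z) = expMetric κ ε C 0 (extChartAt (𝓡∂ n) p z))
    (hsum : ∑ i, ε i = 0) (hq : Continuous q)
    (hF : ∀ z ∈ (extChartAt (𝓡∂ n) p).source, F z = q (extChartAt (𝓡∂ n) p z))
    (hF0 : ∀ z ∉ (extChartAt (𝓡∂ n) p).source, F z = 0) (hFU : ∀ z ∉ U, F z = 0) :
    ∫ z, F z ∂(riemannianVolume g) =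
      √(∏ i, C i) * ∫ y in (extChartAt (𝓡∂ n) p).target, q y := by
  rw [integral_riemannianVolume g p (measurable_of_eq_comp_chart hq hF hF0) hF0,
    ← integral_const_mul]
  refine setIntegral_congr_fun (measurableSet_extChartAt_target p) fun y hy => ?_
  have h1 := hF _ ((extChartAt (𝓡∂ n) p).map_target hy)
  rw [(extChartAt (𝓡∂ n) p).right_inv hy] at h1
  by_cases hyU : (extChartAt (𝓡∂ n) p).symm y ∈ U
  · have h2 := hG _ hyU
    rw [(extChartAt (𝓡∂ n) p).right_inv hy] at h2
    simp only [h1, h2, det_expMetric hsum]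
  · have h3 := hFU _ hyU
    simp only [← h1, h3, mul_zero]

lemma integral_sq_boundaryVolume_pos
    (hG : ∀ z ∈ U, gram g p (extChartAt (𝓡∂ n) p z) = expMetric κ ε C 0 (extChartAt (𝓡∂ n) p z))
    (hUp : U ⊆ (extChartAt (𝓡∂ n) p).source) (hC : ∀ i, 0 < C i)
    (hsupp : tsupport u ⊆ U) (hv : ContDiff ℝ ∞ v) (hvc : HasCompactSupport v)
    (huv : ∀ y ∈ (extChartAt (𝓡∂ n) p).target, u ((extChartAt (𝓡∂ n) p).symm y) = v y)
    {W : Set (EuclideanSpace ℝ (Fin n))} (hW : IsOpen W)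
    (hWT : W ∩ ℍ ⊆ (extChartAt (𝓡∂ n) p).target) (hWv : ∀ y ∈ W ∩ ℍ, v y ≠ 0)
    {y₀ : EuclideanSpace ℝ (Fin n)} (hy₀ : y₀ ∈ W) (hy₀0 : y₀ 0 = 0) :
    0 < ∫ z, u z ^ 2 ∂(boundaryVolume g) := by
  have hu0 : ∀ z ∉ U, u z = 0 := fun z hz =>
    image_eq_zero_of_notMem_tsupport fun h => hz (hsupp h)
  have hdet : ∀ y : EuclideanSpace ℝ (Fin n), 0 < (tangentialGram (expMetric κ ε C 0 y)).det := by
    intro y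
    have : tangentialGram (expMetric κ ε C 0 y) = Matrix.diagonal
        fun i : {i : Fin n // i ≠ 0} => C i * Real.exp (2 * κ * ε i * y 0) := by
      ext i j
      simp [tangentialGram, expMetric, Matrix.diagonal_apply, Subtype.ext_iff]
    rw [this, Matrix.det_diagonal]
    exact Finset.prod_pos fun i _ => mul_pos (hC i) (Real.exp_pos _)
  let Q : EuclideanSpace ℝ {i : Fin n // i ≠ 0} → ℝ := fun w =>
    √(tangentialGram (expMetric κ ε C 0 (boundaryIncl w))).det * v (boundaryIncl w) ^ 2
  have hQ : Continuous Q := by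
    refine (Real.continuous_sqrt.comp (Continuous.matrix_det ?_)).mul
      ((hv.continuous.comp continuous_boundaryIncl).pow 2)
    refine continuous_matrix fun i j => ?_
    exact (contDiff_expMetric_apply (κ := κ) (ε := ε) (C := C) (a := 0) i j).continuous.comp
      continuous_boundaryIncl
  -- A closed embedding is needed for the restriction of `v` to the hyperplane to have compact
  -- support, hence an integrable square.
  have hemb : Topology.IsClosedEmbedding (boundaryIncl (n := n)) :=
    LinearMap.isClosedEmbedding_of_injective (f := (boundaryInclL (n := n)).toLinearMap)
      (LinearMap.ker_eq_bot.2 injective_boundaryIncl)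
  have hQc : HasCompactSupport Q := by
    refine (hvc.comp_isClosedEmbedding hemb).mono fun w hw => ?_
    intro h
    refine hw ?_
    simp only [Function.comp_apply] at h
    simp [Q, h]
  have heq : ∫ z, u z ^ 2 ∂(boundaryVolume g) =
      ∫ w in boundaryIncl ⁻¹' (extChartAt (𝓡∂ n) p).target, Q w := by
    have h0 : ∀ z ∉ (extChartAt (𝓡∂ n) p).source, u z ^ 2 = 0 := fun z hz => by
      rw [hu0 z fun h => hz (hUp h)]
      simp
    have h1 : ∀ z ∈ (extChartAt (𝓡∂ n) p).source, u z ^ 2 = v (extChartAt (𝓡∂ n) p z) ^ 2 :=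
      fun z hz => by
        rw [← huv _ ((extChartAt (𝓡∂ n) p).map_source hz), (extChartAt (𝓡∂ n) p).left_inv hz]
    rw [integral_boundaryVolume g p (measurable_of_eq_comp_chart (q := fun y => v y ^ 2)
      (hv.continuous.pow 2) h1 h0) h0]
    refine setIntegral_congr_fun (measurableSet_boundary_target p) fun w hw => ?_
    simp only [Q]
    by_cases hzU : (extChartAt (𝓡∂ n) p).symm (boundaryIncl w) ∈ U
    · have h2 := hG _ hzU
      rw [(extChartAt (𝓡∂ n) p).right_inv hw] at h2
      rw [h2, huv _ hw]
    · rw [← huv _ hw, hu0 _ hzU]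
      simp
  rw [heq, setIntegral_pos_iff_support_of_nonneg_ae
    (Eventually.of_forall fun w => mul_nonneg (Real.sqrt_nonneg _) (sq_nonneg _))
    (hQ.integrable_of_hasCompactSupport hQc).integrableOn]
  have hWo : IsOpen (boundaryIncl ⁻¹' W) := hW.preimage continuous_boundaryIncl
  refine (hWo.measure_pos volume ⟨boundaryProj y₀, ?_⟩).trans_le (measure_mono fun w hw => ?_)
  · rw [mem_preimage, boundaryIncl_boundaryProj hy₀0]
    exact hy₀
  · have hwW : boundaryIncl w ∈ W ∩ ℍ := ⟨hw, boundaryIncl_mem_halfSpace w⟩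
    exact ⟨mul_ne_zero (Real.sqrt_pos.2 (hdet _)).ne' (pow_ne_zero 2 (hWv _ hwW)), hWT hwW⟩

/-- Nonvanishing is asked only where `y 0 > 0`, so that the lemma applies to `b₀`. Moving slightly
inward from `y₀` shows that this part of `W` is nonempty; it is open, hence of positive measure. -/
lemma setIntegral_sq_pos {v : EuclideanSpace ℝ (Fin n) → ℝ} (hv : Continuous v)
    (hvc : HasCompactSupport v) {W T : Set (EuclideanSpace ℝ (Fin n))} (hW : IsOpen W)
    (hWT : W ∩ ℍ ⊆ T) (hWv : ∀ y ∈ W, 0 < y 0 → v y ≠ 0)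
    {y₀ : EuclideanSpace ℝ (Fin n)} (hy₀ : y₀ ∈ W) (hy₀0 : y₀ 0 = 0) :
    0 < ∫ y in T, v y ^ 2 := by
  have hc2 : HasCompactSupport fun y => v y ^ 2 := hvc.comp_left (g := fun t : ℝ => t ^ 2) (by simp)
  have hint : Integrable (fun y => v y ^ 2) := (hv.pow 2).integrable_of_hasCompactSupport hc2
  rw [setIntegral_pos_iff_support_of_nonneg_ae (ae_of_all _ fun y => sq_nonneg (v y))
    hint.integrableOn]
  have h0 : Continuous fun y : EuclideanSpace ℝ (Fin n) => y 0 :=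
    (EuclideanSpace.proj (0 : Fin n) : EuclideanSpace ℝ (Fin n) →L[ℝ] ℝ).continuous
  have hWo : IsOpen (W ∩ {y | 0 < y 0}) := hW.inter (isOpen_lt continuous_const h0)
  refine (hWo.measure_pos volume ?_).trans_le (measure_mono fun y hy => ⟨?_, hWT ⟨hy.1, ?_⟩⟩)
  · have hc : Tendsto (fun t : ℝ => y₀ + t • EuclideanSpace.single (0 : Fin n) (1 : ℝ)) (𝓝[>] 0)
        (𝓝 y₀) := by
      have : Continuous fun t : ℝ => y₀ + t • EuclideanSpace.single (0 : Fin n) (1 : ℝ) := by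
        fun_prop
      simpa using (this.tendsto 0).mono_left nhdsWithin_le_nhds
    obtain ⟨t, ht, ht0⟩ := ((hc.eventually (hW.mem_nhds hy₀)).and self_mem_nhdsWithin).exists
    refine ⟨_, ht, ?_⟩
    simpa [hy₀0] using ht0
  · exact pow_ne_zero 2 (hWv y hy.1 hy.2)
  · rw [range_modelWithCornersEuclideanHalfSpace]
    have h : 0 < y 0 := hy.2
    exact h.le

end TestFunction

end ConformalBoundary
end

noncomputable section

namespace ConformalBoundary

open scoped Topology Matrix
open Filter

section Estimate

variable {n : ℕ} [NeZero n]

/-! ### The energy of the test functions -/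

/-- Separates the `t²` part from the fixed part. The alternative in `hd` reads: either the metric
dominates the Euclidean one at `y`, or both gradients vanish there. -/
lemma modelDensity_le {c κ t : ℝ} (hc : 0 ≤ c) {ε C : Fin n → ℝ}
    {b b₀ : EuclideanSpace ℝ (Fin n) → ℝ} (hb : ContDiff ℝ ∞ b) (hb₀ : ContDiff ℝ ∞ b₀)
    {y : EuclideanSpace ℝ (Fin n)}
    (hd : (∀ i, 1 ≤ C i * Real.exp (2 * κ * ε i * y 0)) ∨
      (fderiv ℝ b y = 0 ∧ fderiv ℝ b₀ y = 0)) :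
    modelDensity c κ ε C (fun y => t * b y + b₀ y) y ≤
      t ^ 2 * (2 * c * ∑ i, fderiv ℝ b y (EuclideanSpace.single i 1) ^ 2 + 2 * κ ^ 2 * b y ^ 2) +
        (2 * c * ∑ i, fderiv ℝ b₀ y (EuclideanSpace.single i 1) ^ 2 - κ ^ 2 * b₀ y ^ 2) := by
  have hD : fderiv ℝ (fun y => t * b y + b₀ y) y = t • fderiv ℝ b y + fderiv ℝ b₀ y :=
    (((hb.differentiable (by simp) y).hasFDerivAt.const_mul t).add
      (hb₀.differentiable (by simp) y).hasFDerivAt).fderiv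
  have h1 : ∑ i, (C i * Real.exp (2 * κ * ε i * y 0))⁻¹ *
      fderiv ℝ (fun y => t * b y + b₀ y) y (EuclideanSpace.single i 1) ^ 2 ≤
      t ^ 2 * (2 * ∑ i, fderiv ℝ b y (EuclideanSpace.single i 1) ^ 2) +
        2 * ∑ i, fderiv ℝ b₀ y (EuclideanSpace.single i 1) ^ 2 := by
    simp only [Finset.mul_sum]
    rw [← Finset.sum_add_distrib]
    refine Finset.sum_le_sum fun i _ => ?_
    rw [hD]
    simp only [ContinuousLinearMap.add_apply, ContinuousLinearMap.smul_apply, smul_eq_mul]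
    rcases hd with hd | ⟨hd, hd₀⟩
    · have h2 : (C i * Real.exp (2 * κ * ε i * y 0))⁻¹ ≤ 1 := inv_le_one_of_one_le₀ (hd i)
      refine (mul_le_of_le_one_left (sq_nonneg _) h2).trans ?_
      -- This is `(p + q)² ≤ 2p² + 2q²`.
      nlinarith [sq_nonneg (t * fderiv ℝ b y (EuclideanSpace.single i 1) -
        fderiv ℝ b₀ y (EuclideanSpace.single i 1))]
    · simp [hd, hd₀]
  have h2 := mul_le_mul_of_nonneg_left h1 hc
  -- Equivalent to `-2κ²(tb + b₀)² ≤ 2κ²t²b² - κ²b₀²`: half of the negative curvature term of `b₀`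
  -- survives the cross term.
  have h3 : 0 ≤ κ ^ 2 * (2 * t * b y + b₀ y) ^ 2 := by positivity
  rw [modelDensity]
  linarith

lemma hasCompactSupport_sum_fderiv_sq {v : EuclideanSpace ℝ (Fin n) → ℝ}
    (hvc : HasCompactSupport v) :
    HasCompactSupport fun y => ∑ i, fderiv ℝ v y (EuclideanSpace.single i 1) ^ 2 :=
  (hvc.fderiv ℝ).comp_left (g := fun L : EuclideanSpace ℝ (Fin n) →L[ℝ] ℝ =>
    ∑ i, L (EuclideanSpace.single i 1) ^ 2) (by simp)

lemma integrable_sum_fderiv_sq {v : EuclideanSpace ℝ (Fin n) → ℝ} (hv : ContDiff ℝ ∞ v)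
    (hvc : HasCompactSupport v) :
    Integrable fun y => ∑ i, fderiv ℝ v y (EuclideanSpace.single i 1) ^ 2 :=
  (continuous_finsetSum _ fun i _ => (continuous_fderiv_single hv i).pow 2
    ).integrable_of_hasCompactSupport (hasCompactSupport_sum_fderiv_sq hvc)

lemma integrable_sq {v : EuclideanSpace ℝ (Fin n) → ℝ} (hv : ContDiff ℝ ∞ v)
    (hvc : HasCompactSupport v) : Integrable fun y => v y ^ 2 := by
  have hc : HasCompactSupport fun y => v y ^ 2 := hvc.comp_left (g := fun t : ℝ => t ^ 2) (by simp)
  exact (hv.continuous.pow 2).integrable_of_hasCompactSupport hc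

lemma integrable_modelDensity (c κ : ℝ) (ε : Fin n → ℝ) {C : Fin n → ℝ} (hC : ∀ i, 0 < C i)
    {v : EuclideanSpace ℝ (Fin n) → ℝ} (hv : ContDiff ℝ ∞ v) (hvc : HasCompactSupport v) :
    Integrable (modelDensity c κ ε C v) := by
  refine (continuous_modelDensity c κ ε hC hv).integrable_of_hasCompactSupport
    (HasCompactSupport.intro hvc fun y hy => ?_)
  have h : fderiv ℝ v y = 0 := image_eq_zero_of_notMem_tsupport fun h =>
    hy (tsupport_fderiv_subset ℝ h)
  have h' : v y = 0 := image_eq_zero_of_notMem_tsupport hy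
  simp [modelDensity, h, h']

lemma setIntegral_modelDensity_le {c κ t : ℝ} (hc : 0 ≤ c) {ε C : Fin n → ℝ} (hC : ∀ i, 0 < C i)
    {b b₀ : EuclideanSpace ℝ (Fin n) → ℝ} (hb : ContDiff ℝ ∞ b) (hb₀ : ContDiff ℝ ∞ b₀)
    (hbc : HasCompactSupport b) (hb₀c : HasCompactSupport b₀)
    (hd : ∀ y, (∀ i, 1 ≤ C i * Real.exp (2 * κ * ε i * y 0)) ∨
      (fderiv ℝ b y = 0 ∧ fderiv ℝ b₀ y = 0)) (T : Set (EuclideanSpace ℝ (Fin n))) :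
    ∫ y in T, modelDensity c κ ε C (fun y => t * b y + b₀ y) y ≤
      t ^ 2 * (2 * c * (∫ y in T, ∑ i, fderiv ℝ b y (EuclideanSpace.single i 1) ^ 2) +
        2 * κ ^ 2 * ∫ y in T, b y ^ 2) +
      (2 * c * (∫ y in T, ∑ i, fderiv ℝ b₀ y (EuclideanSpace.single i 1) ^ 2) -
        κ ^ 2 * ∫ y in T, b₀ y ^ 2) := by
  have i1 := (integrable_sum_fderiv_sq hb hbc).integrableOn (s := T)
  have i2 := (integrable_sq hb hbc).integrableOn (s := T)
  have i3 := (integrable_sum_fderiv_sq hb₀ hb₀c).integrableOn (s := T)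
  have i4 := (integrable_sq hb₀ hb₀c).integrableOn (s := T)
  have i5 : Integrable (modelDensity c κ ε C fun y => t * b y + b₀ y) :=
    integrable_modelDensity c κ ε hC ((contDiff_const.mul hb).add hb₀) (hbc.mul_left.add hb₀c)
  have i6 := ((i1.const_mul (2 * c)).add (i2.const_mul (2 * κ ^ 2))).const_mul (t ^ 2)
  have i7 := (i3.const_mul (2 * c)).sub (i4.const_mul (κ ^ 2))
  have hmono := integral_mono i5.integrableOn (i6.add i7)
    fun y => modelDensity_le (t := t) hc hb hb₀ (hd y)
  refine hmono.trans_eq ?_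
  rw [integral_add' i6 i7, integral_const_mul, integral_add' (i1.const_mul _) (i2.const_mul _),
    integral_sub' (i3.const_mul _) (i4.const_mul _)]
  simp only [integral_const_mul]

lemma exists_pos_sq_mul_add_neg (Y : ℝ) {Z : ℝ} (hZ : Z < 0) : ∃ t : ℝ, 0 < t ∧ t ^ 2 * Y + Z < 0 := by
  have hc : Tendsto (fun t : ℝ => t ^ 2 * Y + Z) (𝓝[>] 0) (𝓝 Z) := by
    have : Continuous fun t : ℝ => t ^ 2 * Y + Z := by fun_prop
    simpa using (this.tendsto 0).mono_left nhdsWithin_le_nhds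
  obtain ⟨t, ht, ht0⟩ := ((hc.eventually (gt_mem_nhds hZ)).and self_mem_nhdsWithin).exists
  exact ⟨t, ht0, ht⟩

variable {M : Type*} [TopologicalSpace M] [ChartedSpace (EuclideanHalfSpace n) M]
  [IsManifold (𝓡∂ n) ∞ M] [MeasurableSpace M]

lemma firstEigenvalue_neg (hn : 3 ≤ n) {g : SmoothMetric n M} (u : C^∞⟮𝓡∂ n, M; ℝ⟯)
    (hE : energy g u < 0) (hv : 0 < ∫ z, u z ^ 2 ∂(riemannianVolume g))
    (hσ : 0 < ∫ z, u z ^ 2 ∂(boundaryVolume g)) :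
    firstEigenvalueL g < 0 ∧ firstEigenvalueB g < 0 := by
  have hn' : (3 : ℝ) ≤ n := by exact_mod_cast hn
  have hk : 0 < ((n : ℝ) - 2) / (4 * ((n : ℝ) - 1)) := div_pos (by linarith) (by linarith)
  have key : ∀ I : ℝ, 0 < I →
      (((((n : ℝ) - 2) / (4 * ((n : ℝ) - 1)) * energy g u / I : ℝ)) : EReal) < 0 := fun I hI =>
    EReal.coe_neg'.2 (div_neg_of_neg_of_pos (mul_neg_of_pos_of_neg hk hE) hI)
  exact ⟨(iInf₂_le u hv).trans_lt (key _ hv), (iInf₂_le u hσ).trans_lt (key _ hσ)⟩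

/-- The test function lives on the smaller support and the metric is prescribed on the larger one,
so it has model form on an open neighbourhood of the support of the test function. -/
lemma exists_smoothBumpFunction_tsupport_subset [T2Space M] (p : M) :
    ∃ f f₀ : SmoothBumpFunction (𝓡∂ n) p, tsupport f ⊆ Function.support f₀ := by
  obtain ⟨f₀⟩ : Nonempty (SmoothBumpFunction (𝓡∂ n) p) := inferInstance
  have hr := f₀.rOut_pos
  let f : SmoothBumpFunction (𝓡∂ n) p :=
    { rIn := f₀.rOut / 4
      rOut := f₀.rOut / 2
      rIn_pos := by linarith
      rIn_lt_rOut := by linarith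
      closedBall_subset := (inter_subset_inter_left _
        (Metric.closedBall_subset_closedBall (by linarith))).trans f₀.closedBall_subset }
  refine ⟨f, f₀, f.tsupport_subset_symm_image_closedBall.trans ?_⟩
  rw [f₀.support_eq_symm_image]
  exact image_mono (inter_subset_inter_left _ (Metric.closedBall_subset_ball (by
    change f₀.rOut / 2 < f₀.rOut
    linarith)))

end Estimate

end ConformalBoundary
end

/-! ### Choice of the parameters and conclusion -/

noncomputable section

namespace ConformalBoundary

open Filter

/-- A compact manifold with non-empty boundary carries a metric for which both first eigenvalues of
the conformal Laplacian are negative. -/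
theorem exists_metric_firstEigenvalue_neg (n : ℕ) [NeZero n] (hn : 3 ≤ n) (M : Type*) [TopologicalSpace M]
    [ChartedSpace (EuclideanHalfSpace n) M] [IsManifold (𝓡∂ n) ∞ M]
    [CompactSpace M] [T2Space M] [MeasurableSpace M] [BorelSpace M]
    (hM : ((𝓡∂ n).boundary M).Nonempty) :
    ∃ g : SmoothMetric n M,
      firstEigenvalueL g < 0 ∧ firstEigenvalueB g < 0 := by
  obtain ⟨p, hp⟩ := hM
  have hp0 : extChartAt (𝓡∂ n) p p 0 = 0 :=
    (isBoundaryPoint_iff_apply_zero (mem_extChartAt_source p)).1 hp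
  obtain ⟨f, f₀, hff₀⟩ := exists_smoothBumpFunction_tsupport_subset (n := n) p
  obtain ⟨ε, hε1, hε0, hsum, hsq⟩ := exists_weights hn
  have hn' : (3 : ℝ) ≤ n := by exact_mod_cast hn
  set c : ℝ := 4 * ((n : ℝ) - 1) / ((n : ℝ) - 2) with hc_def
  have hc : 0 ≤ c := div_nonneg (by linarith) (by linarith)
  set T := (extChartAt (𝓡∂ n) p).target with hT
  set W := Metric.ball (extChartAt (𝓡∂ n) p p) f.rOut with hW
  have hpW : extChartAt (𝓡∂ n) p p ∈ W := Metric.mem_ball_self f.rOut_pos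
  have hWT : W ∩ range (𝓡∂ n) ⊆ T := f.ball_subset
  -- the bump function in coordinates
  set b : EuclideanSpace ℝ (Fin n) → ℝ := fun y => f.toContDiffBump y with hb_def
  have hb : ContDiff ℝ ∞ b := f.toContDiffBump.contDiff
  have hbc : HasCompactSupport b := f.toContDiffBump.hasCompactSupport
  have hbW : ∀ y ∈ W, 0 < b y := fun y hy => f.toContDiffBump.pos_of_mem_ball hy
  have hcoord : ContDiff ℝ ∞ fun y : EuclideanSpace ℝ (Fin n) => y 0 :=
    (EuclideanSpace.proj (0 : Fin n) : EuclideanSpace ℝ (Fin n) →L[ℝ] ℝ).contDiff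
  set b₀ : EuclideanSpace ℝ (Fin n) → ℝ := fun y => b y * y 0 with hb₀_def
  have hb₀ : ContDiff ℝ ∞ b₀ := hb.mul hcoord
  have hb₀c : HasCompactSupport b₀ := hbc.mul_right
  have hI : 0 < ∫ y in T, b₀ y ^ 2 := setIntegral_sq_pos hb₀.continuous hb₀c Metric.isOpen_ball hWT
    (fun y hy h0 => (mul_pos (hbW y hy) h0).ne') hpW hp0
  -- the metric
  obtain ⟨κ, hκ0, hκ⟩ : ∃ κ : ℝ, 0 ≤ κ ∧
      2 * c * (∫ y in T, ∑ i, fderiv ℝ b₀ y (EuclideanSpace.single i 1) ^ 2) -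
        κ ^ 2 * ∫ y in T, b₀ y ^ 2 < 0 := by
    -- The gradient integral is Euclidean and does not involve `κ`, so `κ²` times the positive
    -- integral of `b₀²` eventually exceeds it.
    obtain ⟨κ, hκ0, hκ⟩ := (((tendsto_pow_atTop (two_ne_zero)).atTop_mul_const hI).eventually_gt_atTop
      (2 * c * (∫ y in T, ∑ i, fderiv ℝ b₀ y (EuclideanSpace.single i 1) ^ 2))).and
      (eventually_ge_atTop (0 : ℝ)) |>.exists
    exact ⟨κ, hκ, by linarith⟩
  -- The factor `exp (2 κ rOut)` compensates the worst decay of `exp (2 κ εᵢ y₀)` on the support of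
  -- `b`, where `|εᵢ y₀| ≤ rOut`; the normal coefficient stays `1`, as the curvature formula
  -- requires.
  set C : Fin n → ℝ := fun i => if i = 0 then 1 else Real.exp (2 * κ * f.rOut) with hC_def
  have hC : ∀ i, 0 < C i := fun i => by
    simp only [hC_def]
    split_ifs
    · exact one_pos
    · exact Real.exp_pos _
  have hC0 : C 0 = 1 := by simp [hC_def]
  obtain ⟨g, hg⟩ := exists_gram_eq_expMetric p (isClosed_tsupport f₀)
    f₀.tsupport_subset_extChartAt_source κ ε hC 0
  have hG : ∀ z ∈ Function.support f₀, gram g p (extChartAt (𝓡∂ n) p z) =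
      expMetric κ ε C 0 (extChartAt (𝓡∂ n) p z) := fun z hz => hg z (subset_tsupport _ hz)
  have hUp : Function.support f₀ ⊆ (extChartAt (𝓡∂ n) p).source :=
    (subset_tsupport _).trans f₀.tsupport_subset_extChartAt_source
  have hd : ∀ y : EuclideanSpace ℝ (Fin n), (∀ i, 1 ≤ C i * Real.exp (2 * κ * ε i * y 0)) ∨
      (fderiv ℝ b y = 0 ∧ fderiv ℝ b₀ y = 0) := by
    intro y
    by_cases hy : y ∈ tsupport b
    · left
      have hy' : y ∈ Metric.closedBall (extChartAt (𝓡∂ n) p p) f.rOut := by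
        rw [← f.toContDiffBump.tsupport_eq]
        exact hy
      -- The centre of the ball is a boundary point, so its coordinate `0` vanishes and `|y 0|` is
      -- at most the distance to the centre.
      have hy0 : |y 0| ≤ f.rOut := by
        have h1 := (PiLp.norm_apply_le (y - extChartAt (𝓡∂ n) p p) 0).trans
          (mem_closedBall_iff_norm.1 hy')
        rwa [PiLp.sub_apply, hp0, sub_zero, Real.norm_eq_abs] at h1
      intro i
      by_cases hi : i = 0
      · rw [hi, hC0, hε0]
        simp
      · simp only [hC_def, if_neg hi]
        rw [← Real.exp_add]
        refine Real.one_le_exp ?_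
        have h2 : |ε i * y 0| ≤ f.rOut := by
          rw [abs_mul]
          exact (mul_le_of_le_one_left (abs_nonneg _) (hε1 i)).trans hy0
        have h3 := neg_le_of_abs_le h2
        nlinarith
    · right
      refine ⟨image_eq_zero_of_notMem_tsupport fun h => hy (tsupport_fderiv_subset ℝ h),
        image_eq_zero_of_notMem_tsupport fun h => hy ?_⟩
      exact tsupport_mul_subset_left (tsupport_fderiv_subset ℝ h)
  have hD : 0 < √(∏ i, C i) := Real.sqrt_pos.2 (Finset.prod_pos fun i _ => hC i)
  set D := √(∏ i, C i) with hD_def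
  -- Only a fixed real number independent of `t` is needed here; neither its sign nor the
  -- integrability of the integrand plays a role.
  set X := ∫ z, meanCurvature g z * f z ^ 2 ∂(boundaryVolume g) with hX
  set A := 2 * c * (∫ y in T, ∑ i, fderiv ℝ b y (EuclideanSpace.single i 1) ^ 2) +
        2 * κ ^ 2 * ∫ y in T, b y ^ 2 with hA
  -- The energy will be bounded by `t² (D A + 2 X)` plus `D` times the negative quantity in `hκ`.
  obtain ⟨t, ht0, ht⟩ := exists_pos_sq_mul_add_neg (D * A + 2 * X)
    (mul_neg_of_pos_of_neg hD hκ)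
  -- the test function
  set v : EuclideanSpace ℝ (Fin n) → ℝ := fun y => t * b y + b₀ y with hv_def
  have hv : ContDiff ℝ ∞ v := (contDiff_const.mul hb).add hb₀
  have hvc : HasCompactSupport v := hbc.mul_left.add hb₀c
  have hvW : ∀ y ∈ W, 0 ≤ y 0 → v y ≠ 0 := fun y hy h0 =>
    (add_pos_of_pos_of_nonneg (mul_pos ht0 (hbW y hy)) (mul_nonneg (hbW y hy).le h0)).ne'
  have hu : ContMDiff (𝓡∂ n) 𝓘(ℝ, ℝ) ∞ fun z => f z • (t + extChartAt (𝓡∂ n) p z 0) := by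
    refine f.contMDiff_smul ?_
    have h1 : ContDiff ℝ ∞ fun y : EuclideanSpace ℝ (Fin n) => t + y 0 := contDiff_const.add hcoord
    exact h1.contMDiff.comp_contMDiffOn (contMDiffOn_extChartAt (I := 𝓡∂ n) (n := ∞) (x := p))
  set u : C^∞⟮𝓡∂ n, M; ℝ⟯ := ⟨fun z => f z • (t + extChartAt (𝓡∂ n) p z 0), hu⟩ with hu_def
  have hu_apply : ∀ z, u z = f z * (t + extChartAt (𝓡∂ n) p z 0) := fun z => rfl
  have hsupp : tsupport u ⊆ Function.support f₀ :=
    (tsupport_smul_subset_left (f : M → ℝ) _).trans hff₀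
  have huv : ∀ y ∈ T, u ((extChartAt (𝓡∂ n) p).symm y) = v y := by
    intro y hy
    have h1 : f ((extChartAt (𝓡∂ n) p).symm y) = b y := by
      rw [f.eqOn_source (by
        rw [← extChartAt_source (𝓡∂ n)]
        exact (extChartAt (𝓡∂ n) p).map_target hy), Function.comp_apply,
        (extChartAt (𝓡∂ n) p).right_inv hy]
    rw [hu_apply, h1, (extChartAt (𝓡∂ n) p).right_inv hy]
    simp only [hv_def, hb₀_def]
    ring
  have huφ : ∀ z ∈ (extChartAt (𝓡∂ n) p).source, u z = v (extChartAt (𝓡∂ n) p z) := fun z hz => by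
    rw [← huv _ ((extChartAt (𝓡∂ n) p).map_source hz), (extChartAt (𝓡∂ n) p).left_inv hz]
  have hu0 : ∀ z ∉ Function.support f₀, u z = 0 := fun z hz =>
    image_eq_zero_of_notMem_tsupport fun h => hz (hsupp h)
  have hF0 : ∀ z ∉ Function.support f₀, c * gradSq g u z + scalarCurvature g z * u z ^ 2 = 0 :=
    fun z hz => by
      rw [hu0 z hz, gradSq_eq_zero g
        (notMem_tsupport_iff_eventuallyEq.1 fun h => hz (hsupp h))]
      simp
  have hint : ∫ z, (c * gradSq g u z + scalarCurvature g z * u z ^ 2) ∂(riemannianVolume g) =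
      D * ∫ y in T, modelDensity c κ ε C v y :=
    integral_riemannianVolume_eq hG hsum (continuous_modelDensity c κ ε hC hv)
      (fun z hz => energyDensity_eq c f₀.isOpen_support hUp hG hC hC0 hε0 hsum hsq hu hsupp hv huv hz)
      (fun z hz => hF0 z fun h => hz (hUp h)) hF0
  have hbdry : ∫ z, meanCurvature g z * u z ^ 2 ∂(boundaryVolume g) = t ^ 2 * X := by
    -- The functions `u` and `t f` differ only where `y 0 ≠ 0` inside the chart, a null set for the
    -- boundary measure.
    have hae : ∀ᵐ z ∂(boundaryVolume g), u z = t * f z := by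
      rw [ae_iff]
      refine boundaryVolume_eq_zero g p (fun z hz => ?_) ?_ fun z hz h0 => hz ?_
      · by_contra h
        refine hz ?_
        have hfz : f z = 0 := by
          by_contra hfz
          exact h (by rw [extChartAt_source]; exact f.support_subset_source hfz)
        rw [hu_apply, hfz]
        simp
      · exact ((isClosed_eq hu.continuous (continuous_const.mul f.continuous)).isOpen_compl
          ).measurableSet
      · rw [hu_apply, h0]
        ring
    -- Pulling out `t²` and replacing the integrand almost everywhere are valid for the Bochner
    -- integral without integrability, so no regularity of the mean curvature is used.
    rw [hX, ← integral_const_mul]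
    refine integral_congr_ae ?_
    filter_upwards [hae] with z hz
    rw [hz]
    ring
  have hle := setIntegral_modelDensity_le (t := t) hc hC hb hb₀ hbc hb₀c hd T
  have hE : energy g u < 0 := by
    rw [energy, ← hc_def, hint, hbdry]
    have := mul_le_mul_of_nonneg_left hle hD.le
    rw [← hA] at this
    linarith
  refine ⟨g, firstEigenvalue_neg hn u hE ?_ ?_⟩
  · rw [integral_riemannianVolume_eq hG hsum (q := fun y => v y ^ 2) (hv.continuous.pow 2)
      (fun z hz => by rw [huφ z hz]) (fun z hz => by rw [hu0 z fun h => hz (hUp h)]; simp)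
      (fun z hz => by rw [hu0 z hz]; simp)]
    exact mul_pos hD (setIntegral_sq_pos hv.continuous hvc Metric.isOpen_ball hWT
      (fun y hy h0 => hvW y hy h0.le) hpW hp0)
  · refine integral_sq_boundaryVolume_pos hG hUp hC hsupp hv hvc huv Metric.isOpen_ball hWT
      (fun y hy => hvW y hy.1 ?_) hpW hp0
    have := hy.2
    rwa [range_modelWithCornersEuclideanHalfSpace] at this

end ConformalBoundary

end

theorem mainTheorem11 (n : ℕ) [NeZero n] (hn : 3 ≤ n) (M : Type*) [TopologicalSpace M]
    [ChartedSpace (EuclideanHalfSpace n) M] [IsManifold (𝓡∂ n) ∞ M]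
    [CompactSpace M] [T2Space M] [MeasurableSpace M] [BorelSpace M]
    (hM : ((𝓡∂ n).boundary M).Nonempty) :
    ∃ g : ConformalBoundary.SmoothMetric n M,
      ConformalBoundary.firstEigenvalueL g < 0 ∧ ConformalBoundary.firstEigenvalueB g < 0 := by
  exact ConformalBoundary.exists_metric_firstEigenvalue_neg n hn M hM
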